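/- **Setup.** A strict partition is a sequence $\lambda=(\lambda_1>\lambda_2>\dots>\lambda_r>0)$ (set $\lambda_i=0$ for $i>r$), with shifted diagram $\mathsf{SD}_\lambda=\{(i,i+j-1): i\ge 1,\ 1\le j\le\lambda_i\}$. Write $\mu\subseteq\lambda$ if $\mathsf{SD}_\mu\subseteq\mathsf{SD}_\lambda$, and put $\mathsf{SD}_{\lambda/\mu}=\mathsf{SD}_\lambda\setminus\mathsf{SD}_\mu$, $|\lambda/\mu|=|\mathsf{SD}_{\lambda/\mu}|$. *Tableaux.* A semistandard set-valued shifted tableau $T$ of shape $\lambda/\mu$ assigns to each $(i,j)\in\mathsf{SD}_{\lambda/\mu}$ a finite nonempty subset $T_{ij}$ of $\{1'<1<2'<2<\cdots\}$ such that $\max T_{ij}\le\min T_{i,j+1}$ and $T_{ij}\cap T_{i,j+1}$ contains only unprimed letters, and $\max T_{ij}\le\min T_{i+1,j}$ and $T_{ij}\cap T_{i+1,j}$ contains only primed letters, whenever both positions are in $\mathsf{SD}_{\lambda/\mu}$. Let $|T|=\sum|T_{ij}|$, and let $z^T$ be the product of $z_k$ over all occurrences of $k$ or $k'$ in $T$.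 In $\mathbb{Z}[\beta][[z_1,z_2,\dots]]$ define $GQ_{\lambda/\mu}=\sum_T\beta^{|T|-|\lambda/\mu|}z^T$, summed over all such $T$, and define $GP_{\lambda/\mu}$ by the same sum restricted to those $T$ with no primed letter in any diagonal position $(i,i)$. *Weyl groups.* $W^B=W^C$ is the group of bijections $w:\mathbb{Z}\to\mathbb{Z}$ with $w(-i)=-w(i)$ for all $i$ and $w(i)=i$ for all but finitely many $i$; $W^D$ is the subgroup of those $w$ with $|\{i>0:w(i)<0\}|$ even. Let $t_0=(-1,1)$, $t_i=(i,i+1)(-i,-i-1)$ for $i\ge1$, and $t_{-1}=(1,-2)(2,-1)$. The simple generators are $t_0,t_1,t_2,\dots$ in types $B,C$ and $t_{-1},t_1,t_2,\dots$ in type $D$. Let $\ell^X$ be the Coxeter length and $\circ$ the Demazure product, that is, the associative product on $W^X$ with $u\circ v=uv$ if $\ell^X(uv)=\ell^X(u)+\ell^X(v)$ and $s\circ s=s$ for simple generators $s$. An element of $W^X$ is fully commutative if any two of its reduced words are related by successive swaps of adjacent commuting generators. *K-Stanley symmetric functions.* Let $X\in\{B,C,D\}$ and $w\in W^X$. Let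 $\mathcal{H}^X(w)$ be the set of finite sequences $a=(a_1,\dots,a_k)$ of indices of simple generators with $w=t_{a_1}\circ\cdots\circ t_{a_k}$; put $\ell(a)=k$. Let $\mathcal{C}^X(a)$ be the set of integer sequences $b=(b_1,\dots,b_k)$ with - $1\le b_1\le\cdots\le b_k$; - $b_{i-1}<b_{i+1}$ whenever $1<i<k$ and $|a_{i-1}|\le|a_i|\ge|a_{i+1}|$; - if $X=B$, then $b_i<b_{i+1}$ whenever $a_i=a_{i+1}=0$; - if $X=D$, then $b_i<b_{i+1}$ whenever $a_i=a_{i+1}\in\{-1,1\}$. Let $o^B(a)=|\{i:a_i=0\}|$, $o^C(a)=0$, $o^D(a)=|\{i:a_i=\pm1\}|$, $|b|=|\{b_1,\dots,b_k\}|$, $\gamma(a,b)=|\{i<k:a_i=a_{i+1},\ b_i=b_{i+1}\}|$ and $z_b=z_{b_1}\cdots z_{b_k}$. Define $$G^X_w=\sum_{a\in\mathcal{H}^X(w)}\ \sum_{b\in\mathcal{C}^X(a)}2^{|b|-\gamma(a,b)-o^X(a)}\,\beta^{\ell(a)-\ell^X(w)}\,z_b,$$ a formal power series in the $z_i$ with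 coefficients in $\mathbb{Q}[\beta]\supset\mathbb{Z}[\beta]$. *The elements.* For strict partitions $\mu\subseteq\lambda$, list the positions of $\mathsf{SD}_{\lambda/\mu}$ row by row from left to right, starting with the smallest row index. Let $a_1,\dots,a_k$ be the values $j-i$ at the listed positions $(i,j)$. Let $b_1,\dots,b_k$ be the values $j-i+1$ if $i\ne j$ and $(-1)^i$ if $i=j$. Put $w_B(\lambda/\mu)=w_C(\lambda/\mu)=t_{a_1}\cdots t_{a_k}$ and $w_D(\lambda/\mu)=t_{b_1}\cdots t_{b_k}$. **Theorem.** Let $\mu\subseteq\lambda$ be strict partitions. Then $w_B(\lambda/\mu)=w_C(\lambda/\mu)$ is a fully commutative element of $W^B=W^C$, $w_D(\lambda/\mu)$ is a fully commutative element of $W^D$, and $$G^B_{w_B(\lambda/\mu)}=GP_{\lambda/\mu},\qquad G^C_{w_C(\lambda/\mu)}=GQ_{\lambda/\mu},\qquad G^D_{w_D(\lambda/\mu)}=GP_{\lambda/\mu}.$$ -/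

import Mathlib

/-! ## Strict partitions and shifted skew shapes -/

/-- A strict partition, given by the list of its nonzero parts. -/
structure StrictPartition where
  parts : List ℕ
  sorted : parts.Pairwise (fun x y => y < x)
  pos : ∀ x ∈ parts, 0 < x

namespace StrictPartition

/-- The `i`-th part of `lam`, for `i = 1, 2, 3, …`; it is zero when `i` exceeds the number of
nonzero parts. -/
def part (lam : StrictPartition) (i : ℕ) : ℕ := lam.parts.getD (i - 1) 0

/-- The shifted diagram: all `(i, i + j - 1)` with `i ≥ 1` and `1 ≤ j ≤ lam_i`. -/
def shiftedDiagram (lam : StrictPartition) : Finset (ℕ × ℕ) :=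
  (Finset.Icc 1 lam.parts.length).biUnion fun i =>
    (Finset.Icc 1 (lam.part i)).image fun j => (i, i + j - 1)

theorem mem_shiftedDiagram (lam : StrictPartition) (i c : ℕ) :
    (i, c) ∈ lam.shiftedDiagram ↔ 1 ≤ i ∧ i ≤ c ∧ c < i + lam.part i := by
  simp only [shiftedDiagram, Finset.mem_biUnion, Finset.mem_Icc, Finset.mem_image, Prod.mk.injEq]
  constructor
  · rintro ⟨k, hk, j, hj, rfl, rfl⟩
    omega
  · rintro ⟨h1, h2, h3⟩
    refine ⟨i, ⟨h1, ?_⟩, c - i + 1, by omega, rfl, by omega⟩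
    by_contra hlt
    have hz : lam.part i = 0 := by
      unfold part
      exact List.getD_eq_default _ _ (by omega)
    omega

/-- The set of positions of the shifted skew shape `lam / mu`. -/
def skewDiagram (lam mu : StrictPartition) : Finset (ℕ × ℕ) :=
  lam.shiftedDiagram \ mu.shiftedDiagram

/-- The positions of `lam / mu`, listed row by row from left to right, starting with the smallest
row index. -/
def readingOrder (lam mu : StrictPartition) : List (ℕ × ℕ) :=
  (((lam.skewDiagram mu).map toLex.toEmbedding).sort (· ≤ ·)).map ofLex

end StrictPartition

/-! ## Formal sums of weighted monomials -/

/-- The formal power series `∑_{s ∈ S} c(s) z^{e(s)}` in variables `z₁, z₂, z₃, …`, where each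
monomial is the weight of finitely many `s ∈ S`. -/
noncomputable def formalSum {ι R : Type} [CommSemiring R] (S : Set ι) (c : ι → R)
    (e : ι → ℕ+ →₀ ℕ) : MvPowerSeries ℕ+ R :=
  fun d => ∑ᶠ (s : ι) (_ : s ∈ S ∧ e s = d), c s

/-! ## Set-valued shifted tableaux and the `K`-theoretic Schur `P`- and `Q`-functions -/

/-- The totally ordered alphabet `1' < 1 < 2' < 2 < ⋯`: the pair `(k, false)` is `k'` and the
pair `(k, true)` is `k`, in lexicographic order. -/
abbrev MarkedLetter : Type := ℕ+ ×ₗ Bool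

/-- The positive integer `k` underlying `k'` or `k`. -/
def MarkedLetter.value (x : MarkedLetter) : ℕ+ := (ofLex x).1

/-- The letter has no prime. -/
def MarkedLetter.IsUnprimed (x : MarkedLetter) : Prop := (ofLex x).2 = true

/-- Fillings of a set of positions by finite sets of letters. -/
abbrev Filling (D : Finset (ℕ × ℕ)) : Type := D → Finset MarkedLetter

namespace Filling

variable {D : Finset (ℕ × ℕ)}

/-- The total number of letters `|T|`. -/
def size (T : Filling D) : ℕ := ∑ p, (T p).card

/-- The exponent of the monomial `z^T`. -/
noncomputable def weight (T : Filling D) : ℕ+ →₀ ℕ :=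
  ∑ p, ∑ x ∈ T p, Finsupp.single (MarkedLetter.value x) 1

/-- Semistandard set-valued shifted tableaux. -/
structure IsSemistandard (T : Filling D) : Prop where
  nonempty : ∀ p, (T p).Nonempty
  row_le : ∀ p q : D, q.1 = (p.1.1, p.1.2 + 1) → ∀ x ∈ T p, ∀ y ∈ T q, x ≤ y
  row_inter : ∀ p q : D, q.1 = (p.1.1, p.1.2 + 1) →
    ∀ x ∈ T p ∩ T q, MarkedLetter.IsUnprimed x
  col_le : ∀ p q : D, q.1 = (p.1.1 + 1, p.1.2) → ∀ x ∈ T p, ∀ y ∈ T q, x ≤ y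
  col_inter : ∀ p q : D, q.1 = (p.1.1 + 1, p.1.2) →
    ∀ x ∈ T p ∩ T q, ¬ MarkedLetter.IsUnprimed x

/-- No primed letter occurs on the main diagonal. -/
def UnprimedDiagonal (T : Filling D) : Prop :=
  ∀ p : D, p.1.1 = p.1.2 → ∀ x ∈ T p, MarkedLetter.IsUnprimed x

end Filling

/-- The `K`-theoretic Schur `P`-function of `lam / mu` in `ℤ[β]⟦z₁, z₂, …⟧`; the polynomial
variable `X` is `β`. -/
noncomputable def skewGP (lam mu : StrictPartition) : MvPowerSeries ℕ+ (Polynomial ℤ) :=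
  formalSum {T : Filling (lam.skewDiagram mu) | T.IsSemistandard ∧ T.UnprimedDiagonal}
    (fun T => Polynomial.X ^ (T.size - (lam.skewDiagram mu).card)) (fun T => T.weight)

/-- The `K`-theoretic Schur `Q`-function of `lam / mu` in `ℤ[β]⟦z₁, z₂, …⟧`. -/
noncomputable def skewGQ (lam mu : StrictPartition) : MvPowerSeries ℕ+ (Polynomial ℤ) :=
  formalSum {T : Filling (lam.skewDiagram mu) | T.IsSemistandard}
    (fun T => Polynomial.X ^ (T.size - (lam.skewDiagram mu).card)) (fun T => T.weight)

/-! ## Signed permutations -/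

/-- The classical types. -/
inductive ClassicalType where
  | B
  | C
  | D

/-- The generators `t_{-1} = (1,-2)(2,-1)`, `t_0 = (-1,1)` and `t_i = (i,i+1)(-i,-i-1)` for `i > 0`;
other indices are not used. -/
def signedGen (a : ℤ) : Equiv.Perm ℤ :=
  if a = 0 then Equiv.swap (-1) 1
  else if 0 < a then Equiv.swap a (a + 1) * Equiv.swap (-a) (-a - 1)
  else if a = -1 then Equiv.swap 1 (-2) * Equiv.swap 2 (-1)
  else 1

/-- Signed permutations of `ℤ`. -/
structure IsSignedPerm (w : Equiv.Perm ℤ) : Prop where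
  map_neg : ∀ i, w (-i) = -w i
  finite_support : {i | w i ≠ i}.Finite

namespace ClassicalType

/-- The group `W^X_∞`, as a set: all signed permutations in types `B` and `C`, and those with an
even number of sign changes in type `D`. -/
def weylGroup : ClassicalType → Set (Equiv.Perm ℤ)
  | B => {w | IsSignedPerm w}
  | C => {w | IsSignedPerm w}
  | D => {w | IsSignedPerm w ∧ Even {i : ℤ | 0 < i ∧ w i < 0}.ncard}

/-- The indices of the simple generators of `W^X_∞`. -/
def IsLetter : ClassicalType → ℤ → Prop
  | B, a => 0 ≤ a
  | C, a => 0 ≤ a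
  | D, a => a = -1 ∨ 1 ≤ a

/-- `a` is a word in the simple generators whose ordinary product is `w`. -/
def IsWordFor (X : ClassicalType) (w : Equiv.Perm ℤ) (a : List ℤ) : Prop :=
  (∀ x ∈ a, X.IsLetter x) ∧ (a.map signedGen).prod = w

/-- The Coxeter length `ℓ^X(w)`: the least number of simple generators with product `w`. -/
noncomputable def length (X : ClassicalType) (w : Equiv.Perm ℤ) : ℕ :=
  sInf {k | ∃ a : List ℤ, X.IsWordFor w a ∧ a.length = k}

/-- Reduced words of `w`. -/
def IsReducedWord (X : ClassicalType) (w : Equiv.Perm ℤ) (a : List ℤ) : Prop :=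
  X.IsWordFor w a ∧ a.length = X.length w

/-- Swap two adjacent letters of a word whose generators commute. -/
inductive CommSwap : List ℤ → List ℤ → Prop
  | swap (l r : List ℤ) (x y : ℤ) (h : Commute (signedGen x) (signedGen y)) :
      CommSwap (l ++ x :: y :: r) (l ++ y :: x :: r)

/-- `w` is a fully commutative element of the Coxeter group `W^X_∞`. -/
def IsFullyCommutative (X : ClassicalType) (w : Equiv.Perm ℤ) : Prop :=
  w ∈ X.weylGroup ∧ ∀ a b : List ℤ, X.IsReducedWord w a → X.IsReducedWord w b →
    Relation.ReflTransGen CommSwap a b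

/-- The Demazure product `w ∘ t_a` of an element of `W^X_∞` with a simple generator, which is
`w t_a` if this is longer than `w` and is `w` otherwise. -/
noncomputable def demazureGen (X : ClassicalType) (w : Equiv.Perm ℤ) (a : ℤ) : Equiv.Perm ℤ :=
  if X.length w < X.length (w * signedGen a) then w * signedGen a else w

/-- Hecke words: `w = t_{a₁} ∘ t_{a₂} ∘ ⋯ ∘ t_{aₖ}`, with the Demazure product of `W^X_∞`
(it is associative, so it is evaluated from left to right). -/
def IsHeckeWord (X : ClassicalType) (w : Equiv.Perm ℤ) (a : List ℤ) : Prop :=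
  (∀ x ∈ a, X.IsLetter x) ∧ a.foldl X.demazureGen 1 = w

/-! ## `K`-Stanley symmetric functions -/

/-- The statistic `o^X(a)`. -/
def oStat : ClassicalType → List ℤ → ℕ
  | B, a => a.countP fun x => x = 0
  | C, _ => 0
  | D, a => a.countP fun x => x = 1 ∨ x = -1

/-- Compatible sequences `b` for a word `a` of the same length. -/
structure IsCompatible (X : ClassicalType) (a : List ℤ) (b : Fin a.length → ℕ+) : Prop where
  monotone : Monotone b
  peak : ∀ i j k : Fin a.length, (j : ℕ) = i + 1 → (k : ℕ) = j + 1 →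
    |a.get i| ≤ |a.get j| → |a.get k| ≤ |a.get j| → b i < b k
  typeB : X = B → ∀ i j : Fin a.length, (j : ℕ) = i + 1 → a.get i = 0 → a.get j = 0 → b i < b j
  typeD : X = D → ∀ i j : Fin a.length, (j : ℕ) = i + 1 → a.get i = a.get j →
    (a.get i = 1 ∨ a.get i = -1) → b i < b j

/-- The statistic `γ(a, b)`: the number of adjacent positions where both sequences repeat. -/
noncomputable def gammaStat (a : List ℤ) (b : Fin a.length → ℕ+) : ℕ :=
  {i : Fin a.length | ∃ j : Fin a.length, (j : ℕ) = i + 1 ∧ a.get i = a.get j ∧ b i = b j}.ncard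

/-- The `K`-Stanley symmetric function
`G^X_w = ∑_a ∑_b 2^{|b| - γ(a,b) - o^X(a)} β^{ℓ(a) - ℓ(w)} z_b`,
over Hecke words `a` for `w` and compatible sequences `b` for `a`. As single exponents of `2` may be
negative in type `D`, the series is formed in `ℚ[β]⟦z₁, z₂, …⟧`. -/
noncomputable def kStanley (X : ClassicalType) (w : Equiv.Perm ℤ) :
    MvPowerSeries ℕ+ (Polynomial ℚ) :=
  formalSum {p : (a : List ℤ) × (Fin a.length → ℕ+) | X.IsHeckeWord w p.1 ∧ X.IsCompatible p.1 p.2}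
    (fun p =>
      Polynomial.C ((2 : ℚ) ^
        (((Finset.univ.image p.2).card : ℤ) - (gammaStat p.1 p.2 : ℤ) - (X.oStat p.1 : ℤ))) *
      Polynomial.X ^ (p.1.length - X.length w))
    (fun p => ∑ i, Finsupp.single (p.2 i) 1)

end ClassicalType

/-! ## The signed permutations of a shifted skew shape -/

namespace StrictPartition

/-- The entries `j - i` of the tableau `T^B` in reading order. -/
def wordB (lam mu : StrictPartition) : List ℤ :=
  (lam.readingOrder mu).map fun p => (p.2 : ℤ) - p.1

/-- The entries of the tableau `T^D` in reading order: `j - i + 1` off the main diagonal and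
`(-1)^i` on it. -/
def wordD (lam mu : StrictPartition) : List ℤ :=
  (lam.readingOrder mu).map fun p => if p.1 = p.2 then (-1) ^ p.1 else (p.2 : ℤ) - p.1 + 1

/-- The signed permutation `w_B(lam / mu) = w_C(lam / mu)`. -/
def permB (lam mu : StrictPartition) : Equiv.Perm ℤ := ((lam.wordB mu).map signedGen).prod

/-- The signed permutation `w_D(lam / mu)`. -/
def permD (lam mu : StrictPartition) : Equiv.Perm ℤ := ((lam.wordD mu).map signedGen).prod

end StrictPartition

/-- The coefficientwise inclusion of `ℤ[β]⟦z₁, z₂, …⟧` into `ℚ[β]⟦z₁, z₂, …⟧`. -/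
noncomputable def toRatSeries :
    MvPowerSeries ℕ+ (Polynomial ℤ) →+* MvPowerSeries ℕ+ (Polynomial ℚ) :=
  MvPowerSeries.map (Polynomial.mapRingHom (Int.castRingHom ℚ))

/-! ## Row functions of shapes and the simple generators -/

namespace ShiftedHecke

open ClassicalType

/-! Both sides are compared through set-valued linear extensions of the skew shape (`IsExt`): lists
of boxes, repetitions allowed, that respect the order of the shape.

On the group side, the element `w` of `f / μ` remembers the removable boxes as its right descents.
The row lengths of `f` are encoded by a Maya diagram, symmetric under exchange of particles and
holes at opposite positions. Adding a box with label `x` moves a particle from `src x` to `tgt x`.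
The element `w` is increasing on particles and never moves a particle up (`MayaInv`), so a descent
at `x` forces a hole at `src x` and a particle at `tgt x`, which is the picture of a removable box.
Hence the length of `w` is the number of boxes (`Reach.length_eq`), and a generator that does not
lengthen `w` is the label of a corner (`Reach.exists_corner`). Labels of distinct corners commute,
so peeling off last letters gives full commutativity (`Reach.reduced_connected`). The same peeling
shows that reading off labels is a bijection from set-valued linear extensions to Hecke words
(`Reach.isHeckeWord`, `Reach.exists_isExt`, `Reach.isExt_injective`).

On the tableau side, the entries of a tableau are sorted by `markKey`. The sorted list determines
the tableau, and semistandardness amounts to its boxes forming a set-valued linear extension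
(`exists_reading`, `IsReading.isSemistandard`, `toFilling_injOn`). Forgetting boxes and primes
leaves a Hecke word `a` and a compatible sequence `b`. The tableaux over a fixed `(a, b)` differ
only in their primes; each letter is forced or free, and the number of free ones is `|b| - γ - o`
(`ncard_primings`, `ncard_fiber`). Summing over fibres gives `kStanley_eq`, uniformly in the three
types. -/

/-- The row lengths `f 0 > f 1 > ⋯` of a shifted shape. -/
def IsShape (f : ℕ → ℕ) : Prop := ∀ i, f (i + 1) ≤ f i - 1

/-- The subtraction in `IsShape` is truncated: rows drop strictly while positive and then stay at
zero. -/
theorem IsShape.le_sub {f : ℕ → ℕ} (hf : IsShape f) {i j : ℕ} (hij : i ≤ j) :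
    f j ≤ f i - (j - i) := by
  induction j, hij using Nat.le_induction with
  | base => simp
  | succ j hij ih => have := hf j; omega

theorem IsShape.eq_of_eq {f : ℕ → ℕ} (hf : IsShape f) {i j : ℕ} (h : f i = f j) (hi : 0 < f i) :
    i = j := by
  rcases lt_trichotomy i j with hij | hij | hij
  · have := hf.le_sub hij.le; omega
  · exact hij
  · have := hf.le_sub hij.le; omega

/-- The shape `g` arises from `f` by adding a box in row `i`. -/
def AddsBox (f : ℕ → ℕ) (i : ℕ) (g : ℕ → ℕ) : Prop := g i = f i + 1 ∧ ∀ j, j ≠ i → g j = f j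

theorem AddsBox.left_unique {f f' g : ℕ → ℕ} {i : ℕ} (h : AddsBox f i g) (h' : AddsBox f' i g) :
    f = f' := by
  funext j
  by_cases hj : j = i
  · subst hj; have := h.1; have := h'.1; omega
  · rw [← h.2 j hj, ← h'.2 j hj]

/-- The index of the generator attached to the box of content `c` in row `i`
(rows are numbered from `0`). -/
def lab (X : ClassicalType) (i c : ℕ) : ℤ :=
  match X with
  | D => if c = 0 then (-1) ^ (i + 1) else c + 1
  | _ => c

theorem neg_one_pow_succ_eq (i : ℕ) :
    ((-1 : ℤ) ^ (i + 1) = 1 ∧ i % 2 = 1) ∨ ((-1 : ℤ) ^ (i + 1) = -1 ∧ i % 2 = 0) := by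
  rcases Nat.even_or_odd i with h | h
  · right; exact ⟨Odd.neg_one_pow h.add_one, Nat.even_iff.1 h⟩
  · left; exact ⟨Even.neg_one_pow h.add_one, Nat.odd_iff.1 h⟩

/-- Puts the label into linear form for arithmetic. Rows are numbered from `0` here, so in type D
the diagonal label is `-1` in even rows and `1` in odd rows. -/
theorem lab_cases (X : ClassicalType) (i c : ℕ) :
    (X ≠ D ∧ lab X i c = c) ∨ (X = D ∧ 0 < c ∧ lab X i c = c + 1) ∨
      (X = D ∧ c = 0 ∧ i % 2 = 1 ∧ lab X i c = 1) ∨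
      (X = D ∧ c = 0 ∧ i % 2 = 0 ∧ lab X i c = -1) := by
  have := neg_one_pow_succ_eq i
  cases X with
  | B => exact Or.inl ⟨by simp, rfl⟩
  | C => exact Or.inl ⟨by simp, rfl⟩
  | D =>
    simp only [lab]
    split_ifs with hc
    all_goals grind

theorem lab_isLetter (X : ClassicalType) (i c : ℕ) : X.IsLetter (lab X i c) := by
  have := lab_cases X i c
  cases X <;> simp_all [IsLetter]; omega

theorem neg_one_le_of_isLetter {X : ClassicalType} {x : ℤ} (hx : X.IsLetter x) : -1 ≤ x := by
  cases X <;> simp only [IsLetter] at hx <;> omega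

theorem neg_one_le_lab (X : ClassicalType) (i c : ℕ) : -1 ≤ lab X i c :=
  neg_one_le_of_isLetter (lab_isLetter X i c)

/-- The position moved up by the generator of index `x`. -/
def src (x : ℤ) : ℤ := if x ≤ 0 then -1 else x

/-- The position to which `src x` is moved. -/
def tgt (x : ℤ) : ℤ := if x = -1 then 2 else x + 1

theorem src_tgt_cases {x : ℤ} (hx : -1 ≤ x) :
    (x = -1 ∧ src x = -1 ∧ tgt x = 2) ∨ (x = 0 ∧ src x = -1 ∧ tgt x = 1) ∨
      (0 < x ∧ src x = x ∧ tgt x = x + 1) := by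
  unfold src tgt
  split_ifs <;> omega

theorem signedGen_apply {x : ℤ} (hx : -1 ≤ x) (z : ℤ) :
    signedGen x z = if z = src x then tgt x else if z = tgt x then src x
      else if z = -src x then -tgt x else if z = -tgt x then -src x else z := by
  rcases src_tgt_cases hx with ⟨h, hs, ht⟩ | ⟨h, hs, ht⟩ | ⟨h, hs, ht⟩
  · subst h; rw [hs, ht]
    have h : signedGen (-1) = Equiv.swap 1 (-2) * Equiv.swap 2 (-1) := by simp [signedGen]
    simp only [h, Equiv.swap_apply_def, Equiv.Perm.mul_apply]
    split_ifs <;> first | omega | contradiction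
  · subst h; rw [hs, ht]
    simp only [signedGen, Equiv.swap_apply_def, if_true]
    split_ifs <;> omega
  · rw [hs, ht]
    simp only [signedGen, Equiv.swap_apply_def, Equiv.Perm.mul_apply, h.ne', h, if_true, if_false]
    split_ifs <;> omega

theorem signedGen_signedGen {x : ℤ} (hx : -1 ≤ x) (z : ℤ) :
    signedGen x (signedGen x z) = z := by
  have h1 := signedGen_apply hx z
  have h2 := signedGen_apply hx (signedGen x z)
  rcases src_tgt_cases hx with ⟨h, hs, ht⟩ | ⟨h, hs, ht⟩ | ⟨h, hs, ht⟩ <;>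
    simp only [hs, ht] at h1 h2 <;> split_ifs at h1 h2 <;> omega

theorem signedGen_mul_self {x : ℤ} (hx : -1 ≤ x) : signedGen x * signedGen x = 1 :=
  Equiv.ext fun z => signedGen_signedGen hx z

theorem mul_signedGen_cancel {x : ℤ} (hx : -1 ≤ x) (w : Equiv.Perm ℤ) :
    w * signedGen x * signedGen x = w := by
  rw [mul_assoc, signedGen_mul_self hx, mul_one]

theorem signedGen_neg {x : ℤ} (hx : -1 ≤ x) (z : ℤ) : signedGen x (-z) = -signedGen x z := by
  have h1 := signedGen_apply hx z
  have h2 := signedGen_apply hx (-z)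
  rcases src_tgt_cases hx with ⟨h, hs, ht⟩ | ⟨h, hs, ht⟩ | ⟨h, hs, ht⟩ <;>
    simp only [hs, ht] at h1 h2 <;> split_ifs at h1 h2 <;> omega

/-- The supports are disjoint. The condition `2 ≤ x + y` discards the pair `-1, 2`, which does not
commute, and the pair `-1, 1`, which commutes but has overlapping supports. -/
theorem commute_signedGen {x y : ℤ} (hx : -1 ≤ x) (hxy : x + 2 ≤ y) (hy : 2 ≤ x + y) :
    Commute (signedGen x) (signedGen y) := by
  apply Equiv.Perm.Disjoint.commute
  intro z
  have h1 := signedGen_apply hx z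
  have h2 := signedGen_apply (x := y) (by omega) z
  rcases src_tgt_cases hx with ⟨h, hs, ht⟩ | ⟨h, hs, ht⟩ | ⟨h, hs, ht⟩ <;>
  rcases src_tgt_cases (x := y) (by omega) with ⟨h', hs', ht'⟩ | ⟨h', hs', ht'⟩ | ⟨h', hs', ht'⟩ <;>
    simp only [hs, ht, hs', ht'] at h1 h2 <;> split_ifs at h1 h2 <;> omega

theorem commute_lab (X : ClassicalType) (i j : ℕ) {c d : ℕ} (h : c + 2 ≤ d) :
    Commute (signedGen (lab X i c)) (signedGen (lab X j d)) := by
  have h1 := lab_cases X i c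
  have h2 := lab_cases X j d
  apply commute_signedGen <;> grind

/-! ### Building a skew shape box by box -/

/-- `Reach X μ f w n`: the shape `f` is obtained from `μ` by adding `n` boxes one by one, and `w` is
the product of the corresponding generators. -/
inductive Reach (X : ClassicalType) (μ : ℕ → ℕ) : (ℕ → ℕ) → Equiv.Perm ℤ → ℕ → Prop
  | base : Reach X μ μ 1 0
  | add {f g : ℕ → ℕ} {w : Equiv.Perm ℤ} {n : ℕ} (i : ℕ) (h : Reach X μ f w n)
      (hg : AddsBox f i g) (hs : IsShape g) : Reach X μ g (w * signedGen (lab X i (f i))) (n + 1)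

variable {X : ClassicalType} {μ f g : ℕ → ℕ} {w w' : Equiv.Perm ℤ} {n m : ℕ}

theorem Reach.isShape (hμ : IsShape μ) (h : Reach X μ f w n) : IsShape f := by
  cases h with
  | base => exact hμ
  | add i h hg hs => exact hs

theorem Reach.le (h : Reach X μ f w n) (i : ℕ) : μ i ≤ f i := by
  induction h with
  | base => exact le_rfl
  | add j h hg hs ih =>
    by_cases hij : i = j
    · subst hij; rw [hg.1]; omega
    · rw [hg.2 i hij]; exact ih

/-- Removing the end of row `i` still leaves it longer than row `i + 1`, which is at least as long
as row `j`. So the contents of two corners differ by at least two, and their labels commute. -/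
theorem corners_apart {f : ℕ → ℕ} (hf : IsShape f) {g₁ g₂ : ℕ → ℕ} {i j : ℕ}
    (h₁ : AddsBox g₁ i f) (h₂ : AddsBox g₂ j f) (hg₁ : IsShape g₁) (hij : i < j) : g₂ j + 2 ≤ g₁ i := by
  have e1 := h₁.1
  have e2 := h₂.1
  have e3 := h₁.2 (i + 1) (by omega)
  have e4 := hg₁ i
  have e5 := hf.le_sub (show i + 1 ≤ j by omega)
  omega

theorem commute_corners {f : ℕ → ℕ} (hf : IsShape f) {g₁ g₂ : ℕ → ℕ} {i j : ℕ}
    (h₁ : AddsBox g₁ i f) (h₂ : AddsBox g₂ j f) (hg₁ : IsShape g₁) (hg₂ : IsShape g₂)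
    (hij : i ≠ j) : Commute (signedGen (lab X i (g₁ i))) (signedGen (lab X j (g₂ j))) := by
  rcases lt_or_gt_of_ne hij with h | h
  · exact (commute_lab X j i (corners_apart hf h₁ h₂ hg₁ h)).symm
  · exact commute_lab X i j (corners_apart hf h₂ h₁ hg₂ h)

/-- Two distinct corners of a shape can be removed one after the other. -/
theorem exists_remove_both {f : ℕ → ℕ} (hf : IsShape f) {g₁ g₂ : ℕ → ℕ} {i j : ℕ}
    (h₁ : AddsBox g₁ i f) (h₂ : AddsBox g₂ j f) (hg₁ : IsShape g₁) (hg₂ : IsShape g₂)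
    (hij : i ≠ j) : ∃ e, IsShape e ∧ AddsBox e j g₁ ∧ AddsBox e i g₂ ∧ e i = g₁ i ∧ e j = g₂ j := by
  have e1 := h₁.1
  have e2 := h₂.1
  have e3 := h₁.2 j hij.symm
  have e4 := h₂.2 i hij
  -- The witness is `f` with both corner boxes removed; this form makes the shape condition a check
  -- by cases.
  have key : ∀ k, (if k = i then g₁ i else g₂ k) = f k - (if k = i then 1 else if k = j then 1 else 0) := by
    intro k
    have := h₂.2 k
    split_ifs with ha hb
    · subst ha; omega
    · subst hb; omega
    · have := this hb; omega
  refine ⟨fun k => if k = i then g₁ i else g₂ k, ?_, ⟨?_, ?_⟩, ⟨?_, ?_⟩, ?_, ?_⟩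
  · intro k
    have a1 := hg₁ k
    have a2 := hg₂ k
    have a3 := hf k
    have b1 := h₁.2 k
    have b2 := h₁.2 (k + 1)
    have b3 := h₂.2 k
    have b4 := h₂.2 (k + 1)
    simp only [key]
    split_ifs <;> grind
  · simp only [if_neg hij.symm]; omega
  · intro k hk
    have := h₁.2 k
    have := h₂.2 k hk
    by_cases hki : k = i <;> simp_all
  · simp only [if_true]; omega
  · intro k hk
    simp [hk]
  · simp
  · simp [hij.symm]

/-- Removing a corner of the skew shape. -/
theorem Reach.remove (hμ : IsShape μ) (h : Reach X μ f w n) {i : ℕ} (hgf : AddsBox g i f)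
    (hg : IsShape g) (hi : μ i ≤ g i) :
    ∃ m, n = m + 1 ∧ Reach X μ g (w * signedGen (lab X i (g i))) m := by
  induction h generalizing g with
  | base => have := hgf.1; omega
  | @add f₁ f w n j h hf hs ih =>
    by_cases hij : i = j
    · subst hij
      obtain rfl := hgf.left_unique hf
      refine ⟨n, rfl, ?_⟩
      rwa [mul_signedGen_cancel (neg_one_le_lab X _ _)]
    -- The box in row `i` was already a corner before the one in row `j` was added. It is removed
    -- there first, the other box is put back, and the two generators are commuted.
    · obtain ⟨e, he, he1, he2, he3, he4⟩ :=
        exists_remove_both hs hgf hf hg (h.isShape hμ) hij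
      obtain ⟨m, rfl, hm⟩ := ih he2 he (by omega)
      refine ⟨m + 1, rfl, ?_⟩
      have := hm.add j he1 hg
      rw [he3, he4, mul_assoc, (commute_corners hs hgf hf hg (h.isShape hμ) hij).eq,
        ← mul_assoc] at this
      exact this

theorem Reach.exists_word (h : Reach X μ f w n) : ∃ a, X.IsWordFor w a ∧ a.length = n := by
  induction h with
  | base => exact ⟨[], ⟨by simp, by simp⟩, rfl⟩
  | @add f₁ f w n j h hf hs ih =>
    obtain ⟨a, ⟨ha, rfl⟩, rfl⟩ := ih
    refine ⟨a ++ [lab X j (f₁ j)], ⟨?_, by simp⟩, by simp⟩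
    intro x hx
    rcases List.mem_append.1 hx with hx | hx
    · exact ha x hx
    · rw [List.mem_singleton.1 hx]; exact lab_isLetter X _ _

end ShiftedHecke

/-! ## Maya diagrams and descents -/

namespace ShiftedHecke

open ClassicalType

variable {X : ClassicalType} {μ f g : ℕ → ℕ} {w w' : Equiv.Perm ℤ} {n m : ℕ}

/-- The shift between row lengths and positions of particles. -/
def shift (X : ClassicalType) : ℤ :=
  match X with
  | D => 1
  | _ => 0

/-- The number of nonempty rows is odd. -/
def OddRows (f : ℕ → ℕ) : Prop := ∃ i, i % 2 = 0 ∧ 0 < f i ∧ f (i + 1) = 0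

/-- Occupied positive positions in the Maya diagram of `f`. -/
def Occ (X : ClassicalType) (f : ℕ → ℕ) (x : ℤ) : Prop :=
  (∃ i, 0 < f i ∧ (f i : ℤ) + shift X = x) ∨ (X = D ∧ x = 1 ∧ OddRows f)

/-- Occupied positions in the Maya diagram of `f`. -/
def Particle (X : ClassicalType) (f : ℕ → ℕ) (x : ℤ) : Prop :=
  (0 < x ∧ Occ X f x) ∨ (x < 0 ∧ ¬ Occ X f (-x))

theorem particle_pos {x : ℤ} (hx : 0 < x) : Particle X f x ↔ Occ X f x := by
  unfold Particle; constructor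
  · rintro (h | h); exacts [h.2, by omega]
  · exact fun h => Or.inl ⟨hx, h⟩

theorem particle_neg {x : ℤ} (hx : 0 < x) : Particle X f (-x) ↔ ¬ Occ X f x := by
  unfold Particle; constructor
  · rintro (h | h); exacts [by omega, by simpa using h.2]
  · exact fun h => Or.inr ⟨by omega, by simpa using h⟩

theorem particle_neg_iff {x : ℤ} (hx : x ≠ 0) : Particle X f (-x) ↔ ¬ Particle X f x := by
  rcases lt_or_gt_of_ne hx with h | h
  · have h1 := particle_neg (X := X) (f := f) (x := -x) (by omega)
    have h2 := particle_pos (X := X) (f := f) (x := -x) (by omega)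
    rw [neg_neg] at h1
    rw [h2, h1, not_not]
  · rw [particle_neg h, particle_pos h]

theorem shift_cases (X : ClassicalType) : (X ≠ D ∧ shift X = 0) ∨ (X = D ∧ shift X = 1) := by
  cases X <;> simp [shift]

theorem IsShape.pos_of_le (hf : IsShape f) {i j : ℕ} (hij : i ≤ j) (h : 0 < f j) : 0 < f i := by
  have := hf.le_sub hij; omega

theorem oddRows_iff_of_pos {i : ℕ} (h : AddsBox f i g) (hi : 0 < f i) :
    OddRows g ↔ OddRows f := by
  have key : ∀ k, (g k = 0 ↔ f k = 0) := by
    intro k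
    have h1 := h.1
    by_cases hk : k = i
    · subst hk; omega
    · rw [h.2 k hk]
  have key' : ∀ k, (0 < g k ↔ 0 < f k) := fun k => by have := key k; omega
  simp only [OddRows, key, key']

/-- A box can start row `i` only if exactly the rows before `i` are nonempty, so parity is read off
from `i`. -/
theorem oddRows_of_zero (hg : IsShape g) {i : ℕ} (h : AddsBox f i g) (hi : f i = 0) :
    (OddRows g ↔ i % 2 = 0) ∧ (OddRows f ↔ i % 2 = 1) := by
  have h1 := h.1
  have hlt : ∀ k, k < i → 0 < f k := fun k hk => by
    have := hg.pos_of_le hk.le (by omega); rwa [h.2 k hk.ne] at this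
  have hge : ∀ k, i < k → f k = 0 := fun k hk => by
    have := hg.le_sub hk.le; rw [h.2 k hk.ne'] at this; omega
  have f0 : ∀ k, (0 < f k ↔ k < i) := fun k => by
    rcases lt_trichotomy k i with hk | hk | hk
    · simp [hk, hlt k hk]
    · simp [hk, hi]
    · simp [hge k hk]; omega
  have g0 : ∀ k, (0 < g k ↔ k ≤ i) := fun k => by
    by_cases hk : k = i
    · subst hk; omega
    · rw [h.2 k hk, f0]; omega
  have f0' : ∀ k, (f k = 0 ↔ i ≤ k) := fun k => by have := f0 k; omega
  have g0' : ∀ k, (g k = 0 ↔ i < k) := fun k => by have := g0 k; omega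
  simp only [OddRows, f0, f0', g0, g0']
  constructor
  · constructor
    · rintro ⟨k, hk⟩; have : k = i := by omega
      subst this; omega
    · intro hk; exact ⟨i, by omega⟩
  · constructor
    · rintro ⟨k, hk⟩; omega
    · intro hk; exact ⟨i - 1, by omega⟩

/-- Adding a box changes the Maya diagram by the corresponding generator. -/
theorem occ_add (hf : IsShape f) (hg : IsShape g) {i : ℕ} (h : AddsBox f i g) :
    (0 < lab X i (f i) ∧ Occ X f (lab X i (f i)) ∧ ¬ Occ X f (lab X i (f i) + 1) ∧
      ¬ Occ X g (lab X i (f i)) ∧ Occ X g (lab X i (f i) + 1) ∧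
      ∀ z, 0 < z → z ≠ lab X i (f i) → z ≠ lab X i (f i) + 1 → (Occ X g z ↔ Occ X f z)) ∨
    (lab X i (f i) = 0 ∧ ¬ Occ X f 1 ∧ Occ X g 1 ∧ ∀ z, 1 < z → (Occ X g z ↔ Occ X f z)) ∨
    (lab X i (f i) = -1 ∧ ¬ Occ X f 1 ∧ ¬ Occ X f 2 ∧ Occ X g 1 ∧ Occ X g 2 ∧
      ∀ z, 2 < z → (Occ X g z ↔ Occ X f z)) := by
  have h1 := h.1
  have hother : ∀ z : ℤ, z ≠ f i + shift X → z ≠ f i + 1 + shift X →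
      ((∃ k, 0 < g k ∧ (g k : ℤ) + shift X = z) ↔ ∃ k, 0 < f k ∧ (f k : ℤ) + shift X = z) := by
    intro z h2 h3
    refine exists_congr fun k => ?_
    by_cases hk : k = i
    · subst hk; rw [h1]; push_cast; constructor <;> intro hh <;> omega
    · rw [h.2 k hk]
  have hf1 : ¬ ∃ k, 0 < f k ∧ (f k : ℤ) + shift X = f i + 1 + shift X := by
    rintro ⟨k, hk, hk'⟩
    have hki : k ≠ i := by rintro rfl; omega
    exact hki (hg.eq_of_eq (by rw [h.2 k hki]; omega) (by rw [h.2 k hki]; omega))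
  have hgi : ∃ k, 0 < g k ∧ (g k : ℤ) + shift X = f i + 1 + shift X := ⟨i, by omega, by omega⟩
  have hg1 : ¬ ∃ k, 0 < g k ∧ (g k : ℤ) + shift X = f i + shift X := by
    rintro ⟨k, hk, hk'⟩
    have hki : k ≠ i := by rintro rfl; omega
    rw [h.2 k hki] at hk hk'
    exact hki (hf.eq_of_eq (by omega) (by omega))
  -- In types B and C a new row creates a particle at `1`. In type D the parity particle intervenes:
  -- a new row of odd index moves it from `1` to `2`, and one of even index fills `1` and `2`
  -- together.
  rcases lab_cases X i (f i) with ⟨hX, hl⟩ | ⟨hX, hc, hl⟩ | ⟨hX, hc, hi, hl⟩ | ⟨hX, hc, hi, hl⟩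
  · have hs : shift X = 0 := by have := shift_cases X; tauto
    have hO : ∀ e z, Occ X e z ↔ ∃ k, 0 < e k ∧ (e k : ℤ) + shift X = z := by
      intro e z; simp [Occ, hX]
    simp only [hO, hl]
    simp only [hs, add_zero] at *
    rcases Nat.eq_zero_or_pos (f i) with h0 | h0
    · right; left
      simp only [h0, Nat.cast_zero, zero_add] at hother hf1 hgi ⊢
      exact ⟨trivial, hf1, hgi, fun z hz => hother z (by omega) (by omega)⟩
    · left
      exact ⟨by omega, ⟨i, h0, rfl⟩, hf1, hg1, hgi, fun z _ h2 h3 => hother z h2 h3⟩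
  · have hs : shift X = 1 := by have := shift_cases X; tauto
    have hodd := oddRows_iff_of_pos h hc
    have hO : ∀ e z, Occ X e z ↔ (∃ k, 0 < e k ∧ (e k : ℤ) + 1 = z) ∨ (z = 1 ∧ OddRows e) := by
      intro e z; unfold Occ; rw [hs]; simp only [hX, true_and]
    simp only [hs] at *
    simp only [hO, hl, hodd]
    left
    refine ⟨by omega, Or.inl ⟨i, hc, rfl⟩, ?_, ?_, Or.inl hgi, fun z _ h2 h3 => ?_⟩
    · rintro (h | h)
      exacts [hf1 h, by omega]
    · rintro (h | h)
      exacts [hg1 h, by omega]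
    · rw [hother z h2 h3]
  all_goals
    have hs : shift X = 1 := by have := shift_cases X; tauto
    have hodd := oddRows_of_zero hg h hc
    have hO : ∀ e z, Occ X e z ↔ (∃ k, 0 < e k ∧ (e k : ℤ) + 1 = z) ∨ (z = 1 ∧ OddRows e) := by
      intro e z; unfold Occ; rw [hs]; simp only [hX, true_and]
    have hone : ∀ e : ℕ → ℕ, ¬ ∃ k, 0 < e k ∧ (e k : ℤ) + 1 = 1 := by
      rintro e ⟨k, hk, hk'⟩; omega
    simp only [hs, hc] at *
    simp only [hl]
    norm_num at hf1 hgi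
  · left
    refine ⟨by norm_num, ?_, ?_, ?_, ?_, ?_⟩
    · rw [hO]; exact Or.inr ⟨rfl, hodd.2.2 hi⟩
    · rw [hO]; norm_num; simpa using hf1
    · rw [hO]; norm_num [hodd.1, hi]; intro k hk; omega
    · rw [hO]; norm_num; simpa using hgi
    · intro z _ h2 h3
      rw [hO, hO, hother z (by push_cast; omega) (by push_cast; omega)]
      simp [h2]
  · right; right
    refine ⟨trivial, ?_, ?_, ?_, ?_, ?_⟩
    · rw [hO]; norm_num [hodd.2, hi]; intro k hk; omega
    · rw [hO]; norm_num; simpa using hf1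
    · rw [hO]; exact Or.inr ⟨rfl, hodd.1.2 hi⟩
    · rw [hO]; norm_num; simpa using hgi
    · intro z h2
      rw [hO, hO, hother z (by push_cast; omega) (by push_cast; omega)]
      simp [show z ≠ 1 by omega]

/-- The mirrored pair of positions moves along automatically, so Maya diagrams transform by
precomposition with the generator. -/
theorem particle_add (hf : IsShape f) (hg : IsShape g) {i : ℕ} (h : AddsBox f i g) :
    Particle X f (src (lab X i (f i))) ∧ ¬ Particle X f (tgt (lab X i (f i))) ∧
      ∀ z, z ≠ 0 → (Particle X g z ↔ Particle X f (signedGen (lab X i (f i)) z)) := by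
  have hx := neg_one_le_lab X i (f i)
  have hocc := occ_add (X := X) hf hg h
  generalize lab X i (f i) = x at *
  -- by symmetry it suffices to treat positive positions
  have hsymm : (∀ z, 0 < z → (Particle X g z ↔ Particle X f (signedGen x z))) →
      ∀ z, z ≠ 0 → (Particle X g z ↔ Particle X f (signedGen x z)) := by
    intro H z hz
    rcases lt_or_gt_of_ne hz with h1 | h1
    · have h2 := H (-z) (by omega)
      have h3 : signedGen x z ≠ 0 := by
        intro h0
        have := signedGen_signedGen hx z
        rw [h0] at this
        have h4 := signedGen_neg hx 0
        rw [neg_zero] at h4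
        omega
      rw [signedGen_neg hx, particle_neg_iff hz, particle_neg_iff h3] at h2
      exact not_iff_not.1 h2
    · exact H z h1
  have n1 : ∀ e : ℕ → ℕ, Particle X e (-1) ↔ ¬ Occ X e 1 := fun e => particle_neg (by norm_num)
  have n2 : ∀ e : ℕ → ℕ, Particle X e (-2) ↔ ¬ Occ X e 2 := fun e => particle_neg (by norm_num)
  have p1 : ∀ e : ℕ → ℕ, Particle X e 1 ↔ Occ X e 1 := fun e => particle_pos (by norm_num)
  have p2 : ∀ e : ℕ → ℕ, Particle X e 2 ↔ Occ X e 2 := fun e => particle_pos (by norm_num)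
  rcases hocc with ⟨h0, a, b, c, d, e⟩ | ⟨h0, a, b, c⟩ | ⟨h0, a, b, c, d, e⟩ <;>
    rcases src_tgt_cases hx with ⟨h', hs, ht⟩ | ⟨h', hs, ht⟩ | ⟨h', hs, ht⟩ <;>
    try omega
  · rw [hs, ht]
    refine ⟨(particle_pos h0).2 a, fun hp => b ((particle_pos (by omega)).1 hp), hsymm fun z hz => ?_⟩
    rw [signedGen_apply hx, hs, ht]
    rcases eq_or_ne z x with rfl | hz1
    · rw [if_pos rfl, particle_pos hz, particle_pos (by omega)]; exact iff_of_false c b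
    rcases eq_or_ne z (x + 1) with rfl | hz2
    · rw [if_neg hz1, if_pos rfl, particle_pos hz, particle_pos (by omega)]
      exact iff_of_true d a
    rw [if_neg hz1, if_neg hz2, if_neg (by omega), if_neg (by omega), particle_pos hz,
      particle_pos hz, e z hz hz1 hz2]
  · rw [hs, ht]
    refine ⟨(n1 f).2 a, fun hp => a ((p1 f).1 hp), hsymm fun z hz => ?_⟩
    rw [signedGen_apply hx, hs, ht]
    rcases eq_or_ne z 1 with rfl | hz1
    · norm_num [n1, p1, a, b]
    rw [if_neg (by omega), if_neg (by omega), if_neg (by omega), if_neg (by omega),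
      particle_pos hz, particle_pos hz, c z (by omega)]
  · rw [hs, ht]
    refine ⟨(n1 f).2 a, fun hp => b ((p2 f).1 hp), hsymm fun z hz => ?_⟩
    rw [signedGen_apply hx, hs, ht]
    rcases eq_or_ne z 1 with rfl | hz1
    · norm_num [n2, p1, b, c]
    rcases eq_or_ne z 2 with rfl | hz2
    · norm_num [n1, p2, a, d]
    rw [if_neg (by omega), if_neg (by omega), if_neg (by omega), if_neg (by omega),
      particle_pos hz, particle_pos hz, e z (by omega)]

/-- A removable pattern in the Maya diagram comes from a removable box. -/
theorem exists_corner (hf : IsShape f) {x : ℤ} (hx : X.IsLetter x) (hs : ¬ Particle X f (src x))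
    (ht : Particle X f (tgt x)) :
    ∃ i g, AddsBox g i f ∧ IsShape g ∧ lab X i (g i) = x ∧ (f i : ℤ) + shift X = tgt x := by
  have hxx := neg_one_le_of_isLetter hx
  suffices H : ∃ i, 0 < f i ∧ f (i + 1) ≤ f i - 1 - 1 ∧ lab X i (f i - 1) = x ∧
      (f i : ℤ) + shift X = tgt x by
    obtain ⟨i, h1, h2, h3, h4⟩ := H
    refine ⟨i, Function.update f i (f i - 1), ⟨?_, ?_⟩, ?_, by simpa using h3, h4⟩
    · simp; omega
    · intro j hj; simp [hj]
    · intro k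
      have := hf k
      simp only [Function.update_apply]
      split_ifs with ha hb hb
      · omega
      · subst ha; omega
      · subst hb; omega
      · omega
  have hT : 0 < tgt x := by rcases src_tgt_cases hxx with h | h | h <;> omega
  rw [particle_pos hT] at ht
  have hlab := fun i => lab_cases X i (f i - 1)
  have hnext := fun i => hf i
  rcases shift_cases X with ⟨hX, hsh⟩ | ⟨hX, hsh⟩
  · have hO : ∀ z, Occ X f z ↔ ∃ k, 0 < f k ∧ (f k : ℤ) = z := by
      intro z; simp [Occ, hX, hsh]
    obtain ⟨i, hi, hi'⟩ := (hO _).1 ht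
    have hx0 : 0 ≤ x := by cases X <;> simp_all [IsLetter]
    have htx : tgt x = x + 1 := by rcases src_tgt_cases hxx with h | h | h <;> omega
    refine ⟨i, hi, ?_, ?_, by omega⟩
    · by_contra hcon
      have h1 : f (i + 1) + 1 = f i := by have := hnext i; omega
      rcases src_tgt_cases hxx with h | h | h
      · omega
      · omega
      · rw [h.2.1, particle_pos h.1, hO] at hs
        exact hs ⟨i + 1, by omega, by omega⟩
    · rcases hlab i with h | h | h | h
      · omega
      all_goals exact absurd h.1 hX
  · have hO : ∀ z, Occ X f z ↔ (∃ k, 0 < f k ∧ (f k : ℤ) + 1 = z) ∨ (z = 1 ∧ OddRows f) := by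
      intro z; unfold Occ; rw [hsh]; simp only [hX, true_and]
    have hx0 : x = -1 ∨ 1 ≤ x := by subst hX; exact hx
    have htx : 2 ≤ tgt x := by rcases src_tgt_cases hxx with h | h | h <;> omega
    obtain ⟨i, hi, hi'⟩ : ∃ k, 0 < f k ∧ (f k : ℤ) + 1 = tgt x := by
      rcases (hO _).1 ht with h | h
      exacts [h, by omega]
    refine ⟨i, hi, ?_, ?_, by omega⟩
    · by_contra hcon
      have h1 : f (i + 1) + 1 = f i := by have := hnext i; omega
      rcases src_tgt_cases hxx with h | h | h
      · omega
      · omega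
      · rw [h.2.1, particle_pos h.1, hO] at hs
        exact hs (Or.inl ⟨i + 1, by omega, by omega⟩)
    · rcases src_tgt_cases hxx with h | h | h
      -- A hole at `-1` means that `1` is occupied. In type D only parity can occupy `1`, so the row
      -- of length one is the last of an odd number of rows and carries the label `-1`.
      · have hodd : OddRows f := by
          rw [h.2.1, particle_neg (by norm_num), not_not, hO] at hs
          rcases hs with ⟨k, hk, hk'⟩ | h
          exacts [by omega, h.2]
        obtain ⟨k, hk, hk1, hk2⟩ := hodd
        have hik : i = k := by
          have h1 := hnext i
          rcases lt_trichotomy i k with h2 | h2 | h2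
          · have := hf.le_sub (show i + 1 ≤ k by omega); omega
          · exact h2
          · have := hf.le_sub (show k + 1 ≤ i by omega); omega
        subst hik
        rcases hlab i with h' | h' | h' | h'
        · exact absurd hX h'.1
        all_goals omega
      · omega
      · rcases hlab i with h' | h' | h' | h'
        · exact absurd hX h'.1
        · omega
        · omega
        -- A last row of length one with even index would make the number of rows odd and so occupy
        -- position `1`, which is assumed empty.
        · exfalso
          have hx1 : x = 1 := by omega
          rw [h.2.1, particle_pos h.1, hO] at hs
          exact hs (Or.inr ⟨hx1, i, h'.2.2.1, hi, by have := hnext i; omega⟩)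

/-- The properties of the signed permutation `w` of a skew shape `f / μ` which determine its
descents. -/
structure MayaInv (X : ClassicalType) (μ f : ℕ → ℕ) (w : Equiv.Perm ℤ) : Prop where
  map_neg : ∀ z, w (-z) = -w z
  lt : ∀ x y, x ≠ 0 → y ≠ 0 → Particle X f x → Particle X f y → x < y → w x < w y
  le : ∀ x, x ≠ 0 → Particle X f x → w x ≤ x
  fixed : ∀ i, 0 < f i → μ i = f i →
    w (f i + shift X) = f i + shift X ∧ ∀ y : ℤ, y < f i + shift X → w y < f i + shift X

/-- Holes are negatives of particles, so `w` never moves a hole down. With a particle at `src x` and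
a hole at `tgt x` this gives `w (src x) ≤ src x < tgt x ≤ w (tgt x)`. -/
theorem MayaInv.lt_of_particle (h : MayaInv X μ f w) {x : ℤ} (hx : -1 ≤ x)
    (hs : Particle X f (src x)) (ht : ¬ Particle X f (tgt x)) : w (src x) < w (tgt x) := by
  rcases src_tgt_cases hx with h' | h' | h' <;>
  · have h1 := h.le (src x) (by omega) hs
    have h2 := h.le (-tgt x) (by omega) ((particle_neg_iff (by omega)).2 ht)
    rw [h.map_neg] at h2
    omega

/-- Of the four patterns at `src x`, `tgt x` only hole–particle allows a descent. The field `fixed`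
then keeps the box out of `μ`: if the whole row belonged to `μ`, then `w` would fix `tgt x` and keep
everything below it below. -/
theorem MayaInv.exists_corner (hf : IsShape f) (h : MayaInv X μ f w) (hle : ∀ i, μ i ≤ f i) {x : ℤ}
    (hx : X.IsLetter x) (hd : w (tgt x) < w (src x)) :
    ∃ i g, AddsBox g i f ∧ IsShape g ∧ lab X i (g i) = x ∧ μ i ≤ g i := by
  have hxx := neg_one_le_of_isLetter hx
  have hs0 : src x ≠ 0 ∧ tgt x ≠ 0 ∧ src x < tgt x := by
    rcases src_tgt_cases hxx with h' | h' | h' <;> omega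
  have hs : ¬ Particle X f (src x) := by
    intro hs
    by_cases ht : Particle X f (tgt x)
    · exact absurd (h.lt _ _ hs0.1 hs0.2.1 hs ht hs0.2.2) (by omega)
    · exact absurd (h.lt_of_particle hxx hs ht) (by omega)
  have ht : Particle X f (tgt x) := by
    by_contra ht
    have := h.lt (-tgt x) (-src x) (by omega) (by omega) ((particle_neg_iff (by omega)).2 ht)
      ((particle_neg_iff (by omega)).2 hs) (by omega)
    rw [h.map_neg, h.map_neg] at this
    omega
  obtain ⟨i, g, h1, h2, h3, h4⟩ := ShiftedHecke.exists_corner hf hx hs ht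
  refine ⟨i, g, h1, h2, h3, ?_⟩
  by_contra hcon
  have h5 := h1.1
  have h6 := hle i
  have h7 := h.fixed i (by omega) (by omega)
  rw [h4] at h7
  have := h7.2 _ hs0.2.2
  omega

theorem mayaInv_base : MayaInv X μ μ 1 where
  map_neg := by simp
  lt := by simp
  le := by simp
  fixed := by simp

theorem MayaInv.add (hf : IsShape f) (hg : IsShape g) (hle : ∀ i, μ i ≤ f i) {i : ℕ}
    (hfg : AddsBox f i g) (h : MayaInv X μ f w) :
    MayaInv X μ g (w * signedGen (lab X i (f i))) := by
  have hx := neg_one_le_lab X i (f i)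
  obtain ⟨hs, ht, hp⟩ := particle_add (X := X) hf hg hfg
  have hlab := lab_cases X i (f i)
  have hsh := shift_cases X
  generalize lab X i (f i) = x at *
  have hcases := src_tgt_cases hx
  have hs' : ¬ Particle X f (-src x) := fun h => (particle_neg_iff (by omega)).1 h hs
  have ht' : Particle X f (-tgt x) := (particle_neg_iff (by omega)).2 ht
  have hne : ∀ z, z ≠ 0 → signedGen x z ≠ 0 := by
    intro z hz h0
    have h1 := signedGen_signedGen hx z
    have h2 := signedGen_neg hx 0
    rw [neg_zero] at h2
    rw [h0] at h1
    omega
  constructor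
  · intro z; simp [signedGen_neg hx, h.map_neg]
  · intro y z hy hz hpy hpz hyz
    rw [hp _ hy] at hpy
    rw [hp _ hz] at hpz
    refine h.lt _ _ (hne y hy) (hne z hz) hpy hpz ?_
    by_contra hcon
    -- In the new diagram `src x` and `-tgt x` are holes, so `y` and `z` avoid them. On the
    -- remaining nonzero positions the generator preserves order.
    have hy1 : y ≠ src x := by
      rintro rfl; apply ht; rwa [signedGen_apply hx, if_pos rfl] at hpy
    have hz1 : z ≠ src x := by
      rintro rfl; apply ht; rwa [signedGen_apply hx, if_pos rfl] at hpz
    have key : ∀ u, u = -tgt x → signedGen x u = -src x := by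
      intro u hu; rw [hu, signedGen_neg hx, signedGen_apply hx, if_neg (by omega), if_pos rfl]
    have hy2 : y ≠ -tgt x := by
      intro hu; rw [key y hu] at hpy; exact hs' hpy
    have hz2 : z ≠ -tgt x := by
      intro hu; rw [key z hu] at hpz; exact hs' hpz
    rw [signedGen_apply hx, signedGen_apply hx] at hcon
    rcases hcases with ⟨h', h1, h2⟩ | ⟨h', h1, h2⟩ | ⟨h', h1, h2⟩ <;>
      simp only [h1, h2] at hcon hy1 hz1 hy2 hz2 <;> split_ifs at hcon <;> omega
  · intro y hy hpy
    rw [hp _ hy] at hpy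
    refine (h.le _ (hne y hy) hpy).trans ?_
    rw [signedGen_apply hx] at hpy ⊢
    split_ifs at hpy ⊢ with h1 h2 h3 h4
    · exact absurd hpy ht
    · omega
    · subst h3; omega
    · exact absurd hpy hs'
    · exact le_rfl
  · intro j hj hμ
    have hji : j ≠ i := by
      rintro rfl; have := hle j; have := hfg.1; omega
    have h1 := hfg.2 j hji
    have h2 : f j ≠ f i + 1 := by
      intro h2
      exact hji (hg.eq_of_eq (by rw [h1, h2, hfg.1]) hj)
    have h3 : f j ≠ f i := by
      intro h3
      exact hji (hf.eq_of_eq h3 (by omega))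
    rw [h1] at hμ hj ⊢
    obtain ⟨h4, h5⟩ := h.fixed j hj hμ
    -- The generator neither moves this position nor carries anything across it. When `x = -1` the
    -- jump from `-1` to `2` passes only over positions up to `1`, and in type D a nonempty row sits
    -- at `2` or higher.
    have h6 : signedGen x (f j + shift X) = f j + shift X ∧
        ∀ y : ℤ, y < f j + shift X → signedGen x y < f j + shift X := by
      have key : signedGen x (f j + shift X) = f j + shift X := by
        rw [signedGen_apply hx]
        rcases hcases with ⟨h', e1, e2⟩ | ⟨h', e1, e2⟩ | ⟨h', e1, e2⟩ <;>
          simp only [e1, e2] <;> split_ifs <;> grind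
      refine ⟨key, fun y hy => ?_⟩
      rw [signedGen_apply hx]
      rcases hcases with ⟨h', e1, e2⟩ | ⟨h', e1, e2⟩ | ⟨h', e1, e2⟩ <;>
        simp only [e1, e2] <;> split_ifs <;> grind
    exact ⟨by simp [h6.1, h4], fun y hy => h5 _ (h6.2 y hy)⟩

theorem Reach.mayaInv (hμ : IsShape μ) (h : Reach X μ f w n) : MayaInv X μ f w := by
  induction h with
  | base => exact mayaInv_base
  | add i h hg hs ih => exact ih.add (h.isShape hμ) hs h.le hg

end ShiftedHecke

/-! ## Inversions and the length function -/

namespace ShiftedHecke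

open ClassicalType

variable {X : ClassicalType} {μ f g : ℕ → ℕ} {w w' : Equiv.Perm ℤ} {n m : ℕ}

/-- Pairs of positions in `[-N, N]` which are roots of type `D`, up to the symmetry
`(i, j) ↦ (-j, -i)`. -/
noncomputable def rootPairs (N : ℕ) : Finset (ℤ × ℤ) :=
  (Finset.Icc (-(N : ℤ)) N ×ˢ Finset.Icc (-(N : ℤ)) N).filter
    fun p => p.1 < p.2 ∧ p.1 ≠ 0 ∧ p.2 ≠ 0 ∧ p.1 ≠ -p.2

theorem mem_rootPairs {N : ℕ} {p : ℤ × ℤ} : p ∈ rootPairs N ↔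
    ((-(N : ℤ) ≤ p.1 ∧ p.1 ≤ N) ∧ (-(N : ℤ) ≤ p.2 ∧ p.2 ≤ N)) ∧
      p.1 < p.2 ∧ p.1 ≠ 0 ∧ p.2 ≠ 0 ∧ p.1 ≠ -p.2 := by
  simp [rootPairs]

/-- Inversions of `w` among a set of pairs. -/
def invSet (S : Finset (ℤ × ℤ)) (w : Equiv.Perm ℤ) : Finset (ℤ × ℤ) :=
  S.filter fun p => w p.2 < w p.1

/-- Sign changes of `w` in `[1, N]`. -/
noncomputable def negSet (N : ℕ) (w : Equiv.Perm ℤ) : Finset ℤ :=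
  (Finset.Icc 1 (N : ℤ)).filter fun i => w i < 0

/-- Twice the number of inversions of type `X` in `[-N, N]`. -/
noncomputable def invCount (X : ClassicalType) (N : ℕ) (w : Equiv.Perm ℤ) : ℕ :=
  (invSet (rootPairs N) w).card +
    match X with
    | D => 0
    | _ => 2 * (negSet N w).card

theorem card_invSet_mul {S : Finset (ℤ × ℤ)} {x : ℤ} (hx : -1 ≤ x)
    (hS : ∀ p ∈ S, (signedGen x p.1, signedGen x p.2) ∈ S) (w : Equiv.Perm ℤ) :
    (invSet S (w * signedGen x)).card = (invSet S w).card := by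
  refine Finset.card_nbij' (fun p => (signedGen x p.1, signedGen x p.2))
    (fun p => (signedGen x p.1, signedGen x p.2)) ?_ ?_ ?_ ?_
  · intro p hp
    obtain ⟨h1, h2⟩ := Finset.mem_filter.1 (Finset.mem_coe.1 hp)
    exact Finset.mem_coe.2 (Finset.mem_filter.2 ⟨hS p h1, h2⟩)
  · intro p hp
    obtain ⟨h1, h2⟩ := Finset.mem_filter.1 (Finset.mem_coe.1 hp)
    exact Finset.mem_coe.2 (Finset.mem_filter.2 ⟨hS p h1, by simpa [signedGen_signedGen hx] using h2⟩)
  · intro p _; simp [signedGen_signedGen hx]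
  · intro p _; simp [signedGen_signedGen hx]

theorem card_invSet_pair {a b : ℤ × ℤ} (hab : a ≠ b) {w : Equiv.Perm ℤ}
    (h : w a.2 < w a.1 ↔ w b.2 < w b.1) :
    (invSet {a, b} w).card = if w a.2 < w a.1 then 2 else 0 := by
  unfold invSet
  split_ifs with h1
  · rw [Finset.filter_true_of_mem]
    · exact Finset.card_pair hab
    · intro p hp
      simp only [Finset.mem_insert, Finset.mem_singleton] at hp
      rcases hp with rfl | rfl
      exacts [h1, h.1 h1]
  · rw [Finset.filter_false_of_mem]
    · rfl
    · intro p hp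
      simp only [Finset.mem_insert, Finset.mem_singleton] at hp
      rcases hp with rfl | rfl
      exacts [h1, fun h2 => h1 (h.2 h2)]

theorem card_invSet_sdiff {S T : Finset (ℤ × ℤ)} (hT : T ⊆ S) (w : Equiv.Perm ℤ) :
    (invSet S w).card = (invSet (S \ T) w).card + (invSet T w).card := by
  unfold invSet
  rw [← Finset.card_union_of_disjoint, ← Finset.filter_union, Finset.sdiff_union_of_subset hT]
  exact Finset.disjoint_filter_filter Finset.sdiff_disjoint

/-- The generator permutes all root pairs except `(src x, tgt x)` and its mirror image, whose
inversion status it reverses. Writing both contributions as summands avoids subtraction in `ℕ`. -/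
theorem card_invSet_mul_of_ne_zero {N : ℕ} {x : ℤ} (hx : -1 ≤ x) (hx0 : x ≠ 0) (hN : x + 1 ≤ N)
    (hN2 : 2 ≤ N) (hw : ∀ z, w (-z) = -w z) :
    (invSet (rootPairs N) (w * signedGen x)).card + (if w (tgt x) < w (src x) then 2 else 0) =
      (invSet (rootPairs N) w).card + (if w (src x) < w (tgt x) then 2 else 0) := by
  have hcases := src_tgt_cases hx
  have hT : ({(src x, tgt x), (-tgt x, -src x)} : Finset (ℤ × ℤ)) ⊆ rootPairs N := by
    intro p hp
    simp only [Finset.mem_insert, Finset.mem_singleton] at hp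
    rw [mem_rootPairs]
    rcases hp with rfl | rfl <;> simp only <;> omega
  have hne : ((src x, tgt x) : ℤ × ℤ) ≠ (-tgt x, -src x) := by
    intro h; rw [Prod.mk.injEq] at h; omega
  have hs : signedGen x (src x) = tgt x := by rw [signedGen_apply hx, if_pos rfl]
  have ht : signedGen x (tgt x) = src x := by rw [← hs, signedGen_signedGen hx]
  rw [card_invSet_sdiff hT, card_invSet_sdiff hT, card_invSet_pair hne, card_invSet_pair hne,
    card_invSet_mul hx]
  · simp only [Equiv.Perm.mul_apply, hs, ht]
    omega
  · intro p hp
    simp only [Finset.mem_sdiff, mem_rootPairs, Finset.mem_insert, Finset.mem_singleton,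
      Prod.ext_iff] at hp ⊢
    have e1 := signedGen_apply hx p.1
    have e2 := signedGen_apply hx p.2
    obtain ⟨p1, p2⟩ := p
    simp only at *
    generalize signedGen x p1 = u1 at *
    generalize signedGen x p2 = u2 at *
    rcases hcases with ⟨h', h1, h2⟩ | ⟨h', h1, h2⟩ | ⟨h', h1, h2⟩ <;>
      simp only [h1, h2] at hp e1 e2 ⊢ <;> split_ifs at e1 e2 <;> omega
  · simp only [hw]; omega
  · simp only [Equiv.Perm.mul_apply, signedGen_neg hx, hw]; omega

/-- The only pair that `t_0` turns around is `(-1, 1)`, which is not among the root pairs; its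
effect is recorded by `negSet` instead. -/
theorem card_invSet_mul_zero {N : ℕ} (w : Equiv.Perm ℤ) :
    (invSet (rootPairs N) (w * signedGen 0)).card = (invSet (rootPairs N) w).card := by
  apply card_invSet_mul (by norm_num)
  intro p hp
  simp only [mem_rootPairs] at hp ⊢
  have e1 := signedGen_apply (x := 0) (by norm_num) p.1
  have e2 := signedGen_apply (x := 0) (by norm_num) p.2
  have h1 : src 0 = -1 := rfl
  have h2 : tgt 0 = 1 := rfl
  obtain ⟨p1, p2⟩ := p
  simp only [h1, h2] at *
  generalize signedGen 0 p1 = u1 at *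
  generalize signedGen 0 p2 = u2 at *
  split_ifs at e1 e2 <;> omega

theorem card_negSet_mul {N : ℕ} {x : ℤ} (hx : 0 < x) (hN : x + 1 ≤ N) (w : Equiv.Perm ℤ) :
    (negSet N (w * signedGen x)).card = (negSet N w).card := by
  have hx' : -1 ≤ x := by omega
  have key : ∀ z, (1 ≤ z ∧ z ≤ (N : ℤ)) → (1 ≤ signedGen x z ∧ signedGen x z ≤ N) := by
    intro z hz
    rw [signedGen_apply hx']
    rcases src_tgt_cases hx' with ⟨h', h1, h2⟩ | ⟨h', h1, h2⟩ | ⟨h', h1, h2⟩ <;>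
      simp only [h1, h2] <;> split_ifs <;> omega
  refine Finset.card_nbij' (signedGen x) (signedGen x) ?_ ?_ ?_ ?_
  · intro z hz
    obtain ⟨h1, h2⟩ := Finset.mem_filter.1 (Finset.mem_coe.1 hz)
    exact Finset.mem_coe.2 (Finset.mem_filter.2
      ⟨Finset.mem_Icc.2 (key z (Finset.mem_Icc.1 h1)), h2⟩)
  · intro z hz
    obtain ⟨h1, h2⟩ := Finset.mem_filter.1 (Finset.mem_coe.1 hz)
    exact Finset.mem_coe.2 (Finset.mem_filter.2
      ⟨Finset.mem_Icc.2 (key z (Finset.mem_Icc.1 h1)), by simpa [signedGen_signedGen hx'] using h2⟩)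
  · intro z _; simp [signedGen_signedGen hx']
  · intro z _; simp [signedGen_signedGen hx']

theorem card_negSet_mul_zero {N : ℕ} (hN : 1 ≤ N) (hw : ∀ z, w (-z) = -w z) :
    (negSet N (w * signedGen 0)).card + (if w 1 < 0 then 1 else 0) =
      (negSet N w).card + (if 0 < w 1 then 1 else 0) := by
  have hsplit : ∀ v : Equiv.Perm ℤ, (negSet N v).card =
      ((Finset.Icc 2 (N : ℤ)).filter fun i => v i < 0).card + (if v 1 < 0 then 1 else 0) := by
    intro v
    have h1 : Finset.Icc 1 (N : ℤ) = insert 1 (Finset.Icc 2 (N : ℤ)) := by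
      ext z; simp only [Finset.mem_insert, Finset.mem_Icc]; omega
    have h2 : (1 : ℤ) ∉ (Finset.Icc 2 (N : ℤ)).filter fun i => v i < 0 := by simp
    rw [negSet, h1, Finset.filter_insert]
    split_ifs with h
    · rw [Finset.card_insert_of_notMem h2]
    · rfl
  have h1 : (Finset.Icc 2 (N : ℤ)).filter (fun i => (w * signedGen 0) i < 0) =
      (Finset.Icc 2 (N : ℤ)).filter fun i => w i < 0 := by
    apply Finset.filter_congr
    intro z hz
    rw [Finset.mem_Icc] at hz
    have : signedGen 0 z = z := by
      rw [signedGen_apply (by norm_num), show src 0 = -1 from rfl, show tgt 0 = 1 from rfl]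
      split_ifs <;> omega
    simp [this]
  have h2 : (w * signedGen 0) 1 = -w 1 := by
    have : signedGen 0 1 = -1 := by
      rw [signedGen_apply (by norm_num), show src 0 = -1 from rfl, show tgt 0 = 1 from rfl]
      norm_num
    simp [this, hw]
  rw [hsplit, hsplit, h1, h2]
  split_ifs <;> omega

theorem invCount_mul {N : ℕ} {x : ℤ} (hx : X.IsLetter x) (hN : x + 1 ≤ N) (hN2 : 2 ≤ N)
    (hw : ∀ z, w (-z) = -w z) :
    invCount X N (w * signedGen x) + (if w (tgt x) < w (src x) then 2 else 0) =
      invCount X N w + (if w (src x) < w (tgt x) then 2 else 0) := by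
  have hx1 := neg_one_le_of_isLetter hx
  have hBC : 0 ≤ x → (invSet (rootPairs N) (w * signedGen x)).card +
      2 * (negSet N (w * signedGen x)).card + (if w (tgt x) < w (src x) then 2 else 0) =
      (invSet (rootPairs N) w).card + 2 * (negSet N w).card +
        (if w (src x) < w (tgt x) then 2 else 0) := by
    intro hx0
    rcases hx0.eq_or_lt with rfl | hx0
    · have h1 := card_invSet_mul_zero (N := N) w
      have h2 := card_negSet_mul_zero (N := N) (by omega) hw
      have h3 : w (src 0) = -w 1 := by rw [← hw]; rfl
      have h4 : w (tgt 0) = w 1 := rfl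
      rw [h3, h4, h1]
      split_ifs at h2 ⊢ <;> omega
    · have h1 := card_invSet_mul_of_ne_zero hx1 hx0.ne' hN hN2 hw
      have h2 := card_negSet_mul hx0 hN w
      omega
  cases X with
  | B => exact hBC hx
  | C => exact hBC hx
  | D =>
    simp only [invCount, add_zero]
    have hx0 : x ≠ 0 := by simp only [IsLetter] at hx; omega
    exact card_invSet_mul_of_ne_zero hx1 hx0 hN hN2 hw

theorem invCount_one (N : ℕ) : invCount X N 1 = 0 := by
  have h1 : invSet (rootPairs N) 1 = ∅ := by
    apply Finset.filter_false_of_mem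
    intro p hp
    rw [mem_rootPairs] at hp
    simp only [Equiv.Perm.one_apply]
    omega
  have h2 : negSet N 1 = ∅ := by
    apply Finset.filter_false_of_mem
    intro p hp
    rw [Finset.mem_Icc] at hp
    simp only [Equiv.Perm.one_apply]
    omega
  cases X <;> simp [invCount, h1, h2]

theorem isSignedPerm_one : IsSignedPerm 1 := ⟨by simp, by simp⟩

theorem isSignedPerm_mul {x : ℤ} (hx : -1 ≤ x) (hw : IsSignedPerm w) :
    IsSignedPerm (w * signedGen x) := by
  refine ⟨fun i => by simp [signedGen_neg hx, hw.map_neg], ?_⟩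
  refine (hw.finite_support.union
    (Set.toFinite {src x, tgt x, -src x, -tgt x})).subset fun i hi => ?_
  by_contra hcon
  simp only [Set.mem_union, Set.mem_ofPred_eq, Set.mem_insert_iff, Set.mem_singleton_iff,
    not_or, not_not] at hcon
  apply hi
  rw [Equiv.Perm.mul_apply, signedGen_apply hx, if_neg hcon.2.1, if_neg hcon.2.2.1,
    if_neg hcon.2.2.2.1, if_neg hcon.2.2.2.2, hcon.1]

theorem isSignedPerm_prod {a : List ℤ} (ha : ∀ x ∈ a, -1 ≤ x) :
    IsSignedPerm (a.map signedGen).prod := by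
  induction a using List.reverseRecOn with
  | nil => simpa using isSignedPerm_one
  | append_singleton a x ih =>
    simp only [List.map_append, List.map_cons, List.map_nil, List.prod_append, List.prod_singleton]
    exact isSignedPerm_mul (ha x (by simp)) (ih fun y hy => ha y (by simp [hy]))

theorem invCount_prod_le {N : ℕ} (hN2 : 2 ≤ N) {a : List ℤ} (ha : ∀ x ∈ a, X.IsLetter x)
    (hN : ∀ x ∈ a, x + 1 ≤ (N : ℤ)) : invCount X N (a.map signedGen).prod ≤ 2 * a.length := by
  induction a using List.reverseRecOn with
  | nil => simp [invCount_one]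
  | append_singleton a x ih =>
    simp only [List.map_append, List.map_cons, List.map_nil, List.prod_append, List.prod_singleton,
      List.length_append, List.length_singleton]
    have h1 := ih (fun y hy => ha y (by simp [hy])) (fun y hy => hN y (by simp [hy]))
    have h2 := invCount_mul (ha x (by simp)) (hN x (by simp)) hN2
      (isSignedPerm_prod (a := a) fun y hy => neg_one_le_of_isLetter (ha y (by simp [hy]))).map_neg
    split_ifs at h2 <;> omega

theorem Reach.exists_invCount (hμ : IsShape μ) (h : Reach X μ f w n) :
    ∃ N₀ : ℕ, ∀ N : ℕ, N₀ ≤ N → invCount X N w = 2 * n := by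
  induction h with
  | base => exact ⟨0, fun N _ => by simp [invCount_one]⟩
  | @add f g w n i h hg hs ih =>
    obtain ⟨N₀, hN₀⟩ := ih
    refine ⟨max (max N₀ 2) (lab X i (f i) + 1).toNat, fun N hN => ?_⟩
    have h1 := hN₀ N (by omega)
    have hinv := h.mayaInv hμ
    have h2 := invCount_mul (lab_isLetter X i (f i)) (N := N) (by omega) (by omega) hinv.map_neg
    have h3 := particle_add (X := X) (h.isShape hμ) hs hg
    have h4 := hinv.lt_of_particle (neg_one_le_lab X i (f i)) h3.1 h3.2.1
    rw [if_neg (by omega), if_pos h4] at h2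
    omega

/-! ### Coxeter length and descents of the element of a skew shape -/

theorem exists_bound (a : List ℤ) : ∃ N : ℕ, ∀ x ∈ a, x ≤ (N : ℤ) := by
  induction a with
  | nil => exact ⟨0, by simp⟩
  | cons y a ih =>
    obtain ⟨N, hN⟩ := ih
    refine ⟨max N y.toNat, fun x hx => ?_⟩
    rcases List.mem_cons.1 hx with rfl | hx
    · omega
    · have := hN x hx; omega

theorem length_le {a : List ℤ} (ha : X.IsWordFor w a) : X.length w ≤ a.length :=
  Nat.sInf_le ⟨a, ha, rfl⟩

theorem exists_reduced {a : List ℤ} (ha : X.IsWordFor w a) : ∃ b, X.IsReducedWord w b := by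
  obtain ⟨b, hb, hb'⟩ := Nat.sInf_mem (s := {k | ∃ a : List ℤ, X.IsWordFor w a ∧ a.length = k})
    ⟨_, a, ha, rfl⟩
  exact ⟨b, hb, hb'⟩

/-- Each letter raises the doubled inversion count by at most two once `N` exceeds all letters of
the word. Applied to a shortest word, this one inequality replaces the general equality of length
and inversion number. -/
theorem le_length_of_invCount {k : ℕ} {a : List ℤ} (ha : X.IsWordFor w a)
    (h : ∃ N₀ : ℕ, ∀ N : ℕ, N₀ ≤ N → 2 * k ≤ invCount X N w) : k ≤ X.length w := by
  obtain ⟨b, hb, hb'⟩ := exists_reduced ha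
  obtain ⟨N₀, hN₀⟩ := h
  obtain ⟨N₁, hN₁⟩ := exists_bound b
  have h1 := hN₀ (N₀ + N₁ + 2) (by omega)
  have h2 := invCount_prod_le (N := N₀ + N₁ + 2) (by omega) hb.1
    (fun x hx => by have := hN₁ x hx; push_cast; omega)
  rw [hb.2] at h2
  omega

theorem Reach.length_eq (hμ : IsShape μ) (h : Reach X μ f w n) : X.length w = n := by
  obtain ⟨a, ha, hn⟩ := h.exists_word
  apply le_antisymm
  · rw [← hn]; exact length_le ha
  · obtain ⟨N, hN⟩ := h.exists_invCount hμ
    exact le_length_of_invCount ha ⟨N, fun M hM => (hN M hM).ge⟩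

theorem isWordFor_append {a : List ℤ} (ha : X.IsWordFor w a) {x : ℤ} (hx : X.IsLetter x) :
    X.IsWordFor (w * signedGen x) (a ++ [x]) := by
  refine ⟨fun y hy => ?_, by simp [ha.2]⟩
  rcases List.mem_append.1 hy with hy | hy
  · exact ha.1 y hy
  · rwa [List.mem_singleton.1 hy]

/-- The inversion count of `w` is exactly `2 * n`, and an ascent adds two more. -/
theorem Reach.length_lt_of_lt (hμ : IsShape μ) (h : Reach X μ f w n) {x : ℤ} (hx : X.IsLetter x)
    (hlt : w (src x) < w (tgt x)) : n < X.length (w * signedGen x) := by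
  obtain ⟨a, ha, -⟩ := h.exists_word
  obtain ⟨N₀, hN₀⟩ := h.exists_invCount hμ
  refine le_length_of_invCount (isWordFor_append ha hx) ⟨N₀ + 2 + x.toNat + 1, fun N hN => ?_⟩
  have h1 := hN₀ N (by omega)
  have h2 := invCount_mul hx (N := N) (by omega) (by omega) (h.mayaInv hμ).map_neg
  rw [if_neg (by omega), if_pos hlt] at h2
  omega

/-- If multiplication by a generator does not increase the length, then the generator is the label
of a corner. -/
theorem Reach.exists_corner (hμ : IsShape μ) (h : Reach X μ f w n) {x : ℤ} (hx : X.IsLetter x)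
    (hle : X.length (w * signedGen x) ≤ n) :
    ∃ i g m, AddsBox g i f ∧ IsShape g ∧ μ i ≤ g i ∧ lab X i (g i) = x ∧ n = m + 1 ∧
      Reach X μ g (w * signedGen x) m := by
  have hxx := neg_one_le_of_isLetter hx
  have hne : w (src x) ≠ w (tgt x) := fun he => by
    have := w.injective he
    rcases src_tgt_cases hxx with h' | h' | h' <;> omega
  have hd : w (tgt x) < w (src x) := by
    by_contra hcon
    have := h.length_lt_of_lt hμ hx (by omega)
    omega
  obtain ⟨i, g, h1, h2, h3, h4⟩ := (h.mayaInv hμ).exists_corner (h.isShape hμ) h.le hx hd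
  obtain ⟨m, hm, hm'⟩ := h.remove hμ h1 h2 h4
  rw [h3] at hm'
  exact ⟨i, g, m, h1, h2, h4, h3, hm, hm'⟩

/-! ## Full commutativity -/

theorem isReducedWord_append {a : List ℤ} (ha : X.IsReducedWord w a) {x : ℤ} (hx : X.IsLetter x)
    (hl : X.length (w * signedGen x) = X.length w + 1) :
    X.IsReducedWord (w * signedGen x) (a ++ [x]) :=
  ⟨isWordFor_append ha.1 hx, by simp [ha.2, hl]⟩

theorem reflTransGen_append {a b : List ℤ} (h : Relation.ReflTransGen CommSwap a b) (c : List ℤ) :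
    Relation.ReflTransGen CommSwap (a ++ c) (b ++ c) := by
  refine Relation.ReflTransGen.lift (p := CommSwap) (· ++ c) ?_ _ _ h
  rintro _ _ ⟨l, r, x, y, hxy⟩
  have := CommSwap.swap l (r ++ c) x y hxy
  simpa [Function.onFun] using this

/-- The last letter of a reduced word is the label of a corner. -/
theorem Reach.reduced_append (hμ : IsShape μ) (h : Reach X μ f w n) {a : List ℤ} {x : ℤ}
    (ha : X.IsReducedWord w (a ++ [x])) :
    ∃ i g m, AddsBox g i f ∧ IsShape g ∧ μ i ≤ g i ∧ lab X i (g i) = x ∧ n = m + 1 ∧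
      Reach X μ g (w * signedGen x) m ∧ X.IsReducedWord (w * signedGen x) a := by
  have hx : X.IsLetter x := ha.1.1 x (by simp)
  have hw : w * signedGen x = (a.map signedGen).prod := by
    rw [← ha.1.2]
    simp only [List.map_append, List.map_cons, List.map_nil, List.prod_append, List.prod_singleton]
    exact mul_signedGen_cancel (neg_one_le_of_isLetter hx) _
  have hword : X.IsWordFor (w * signedGen x) a := ⟨fun y hy => ha.1.1 y (by simp [hy]), hw.symm⟩
  have hlen := ha.2
  rw [h.length_eq hμ, List.length_append, List.length_singleton] at hlen
  obtain ⟨i, g, m, h1, h2, h3, h4, h5, h6⟩ := h.exists_corner hμ hx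
    (by have := length_le hword; omega)
  exact ⟨i, g, m, h1, h2, h3, h4, h5, h6, hword, by rw [h6.length_eq hμ]; omega⟩

/-- A diamond argument on the last letters. If they come from different corners, both words are
connected by induction to words ending in the two commuting labels. -/
theorem Reach.reduced_connected (hμ : IsShape μ) (h : Reach X μ f w n) {a b : List ℤ}
    (ha : X.IsReducedWord w a) (hb : X.IsReducedWord w b) :
    Relation.ReflTransGen CommSwap a b := by
  induction n generalizing f w a b with
  | zero =>
    have h1 := ha.2
    have h2 := hb.2
    rw [h.length_eq hμ, List.length_eq_zero_iff] at h1 h2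
    rw [h1, h2]
  | succ n ih =>
    have h1 := ha.2
    have h2 := hb.2
    rw [h.length_eq hμ] at h1 h2
    obtain ⟨a, x, rfl⟩ := List.eq_nil_or_concat' a |>.resolve_left (by rintro rfl; simp at h1)
    obtain ⟨b, y, rfl⟩ := List.eq_nil_or_concat' b |>.resolve_left (by rintro rfl; simp at h2)
    obtain ⟨i, g₁, m₁, hi, hg₁, hμ₁, rfl, e₁, r₁, ha'⟩ := h.reduced_append hμ ha
    obtain ⟨j, g₂, m₂, hj, hg₂, hμ₂, rfl, e₂, r₂, hb'⟩ := h.reduced_append hμ hb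
    obtain rfl : n = m₁ := by omega
    obtain rfl : n = m₂ := by omega
    by_cases hij : i = j
    · subst hij
      obtain rfl := hi.left_unique hj
      exact reflTransGen_append (ih r₁ ha' hb') _
    · have hcomm := commute_corners (X := X) (h.isShape hμ) hi hj hg₁ hg₂ hij
      obtain ⟨e, he, he₁, he₂, hei, hej⟩ := exists_remove_both (h.isShape hμ) hi hj hg₁ hg₂ hij
      obtain ⟨k, rfl, r⟩ := r₁.remove hμ he₁ he (by omega)
      obtain ⟨k', hk', r'⟩ := r₂.remove hμ he₂ he (by omega)
      rw [hej] at r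
      rw [hei] at r'
      obtain rfl : k = k' := by omega
      -- `c` spells the shape with both corners removed; appending the two labels in either order
      -- gives the middle of the chain.
      obtain ⟨c, hc, -⟩ := r.exists_word
      obtain ⟨c, hc⟩ := exists_reduced hc
      have hcx : X.IsReducedWord (w * signedGen (lab X i (g₁ i))) (c ++ [lab X j (g₂ j)]) := by
        have := isReducedWord_append hc (lab_isLetter X j (g₂ j))
          (by rw [mul_signedGen_cancel (neg_one_le_lab X _ _), r.length_eq hμ, r₁.length_eq hμ])
        rwa [mul_signedGen_cancel (neg_one_le_lab X _ _)] at this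
      have hc' : X.IsReducedWord
          (w * signedGen (lab X j (g₂ j)) * signedGen (lab X i (g₁ i))) c := by
        rwa [mul_assoc, ← hcomm.eq, ← mul_assoc]
      have hcy : X.IsReducedWord (w * signedGen (lab X j (g₂ j))) (c ++ [lab X i (g₁ i)]) := by
        have := isReducedWord_append hc' (lab_isLetter X i (g₁ i))
          (by rw [mul_signedGen_cancel (neg_one_le_lab X _ _), r'.length_eq hμ, r₂.length_eq hμ])
        rwa [mul_signedGen_cancel (neg_one_le_lab X _ _)] at this
      refine (reflTransGen_append (ih r₁ ha' hcx) _).trans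
        (Relation.ReflTransGen.head ?_ (reflTransGen_append (ih r₂ hcy hb') _))
      have := CommSwap.swap c [] _ _ hcomm.symm
      simpa using this

/-! ## Membership in the Weyl groups -/

theorem even_negs_mul_pos {x : ℤ} (hx : 0 < x) (w : Equiv.Perm ℤ) :
    {i : ℤ | 0 < i ∧ (w * signedGen x) i < 0}.ncard = {i : ℤ | 0 < i ∧ w i < 0}.ncard := by
  have hx' : -1 ≤ x := by omega
  have : {i : ℤ | 0 < i ∧ (w * signedGen x) i < 0} = signedGen x '' {i : ℤ | 0 < i ∧ w i < 0} := by
    have hpos : ∀ z, 0 < z → 0 < signedGen x z := by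
      intro z hz
      rw [signedGen_apply hx']
      rcases src_tgt_cases hx' with ⟨h', h1, h2⟩ | ⟨h', h1, h2⟩ | ⟨h', h1, h2⟩ <;>
        simp only [h1, h2] <;> split_ifs <;> omega
    ext z
    constructor
    · intro hz
      exact ⟨signedGen x z, ⟨hpos z hz.1, hz.2⟩, signedGen_signedGen hx' z⟩
    · rintro ⟨y, hy, rfl⟩
      exact ⟨hpos y hy.1, by simpa [signedGen_signedGen hx'] using hy.2⟩
  rw [this, Set.ncard_image_of_injective _ (signedGen x).injective]

/-- Only the sign of `w 1` is reversed, and `w 1 ≠ 0` because `w` is odd and injective. -/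
theorem even_negs_mul_zero (hw : IsSignedPerm w) :
    Even {i : ℤ | 0 < i ∧ (w * signedGen 0) i < 0}.ncard ↔ ¬ Even {i : ℤ | 0 < i ∧ w i < 0}.ncard := by
  have hfin : {i : ℤ | 0 < i ∧ w i < 0}.Finite :=
    hw.finite_support.subset fun i hi => by
      simp only [Set.mem_ofPred_eq] at hi ⊢; omega
  have h0 : ∀ z, signedGen 0 z = if z = -1 then 1 else if z = 1 then -1 else z := by
    intro z
    rw [signedGen_apply (by norm_num), show src 0 = -1 from rfl, show tgt 0 = 1 from rfl]
    split_ifs <;> omega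
  have hw1 : w 1 ≠ 0 := by
    intro h
    have h1 := hw.map_neg 1
    have := w.injective (h1.trans (by rw [h]; rfl : -w 1 = w 1))
    omega
  have hw2 := hw.map_neg 1
  by_cases h1 : w 1 < 0
  · have : {i : ℤ | 0 < i ∧ (w * signedGen 0) i < 0} = {i : ℤ | 0 < i ∧ w i < 0} \ {1} := by
      ext z
      simp only [Set.mem_ofPred_eq, Equiv.Perm.mul_apply, h0, Set.mem_sdiff, Set.mem_singleton_iff]
      split_ifs with ha hb
      · omega
      · subst hb; omega
      · simp [hb]
    rw [this]
    have := Set.ncard_sdiff_singleton_add_one (show (1 : ℤ) ∈ {i : ℤ | 0 < i ∧ w i < 0} from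
      ⟨by norm_num, h1⟩) hfin
    rw [← this, Nat.even_add_one, not_not]
  · have : {i : ℤ | 0 < i ∧ (w * signedGen 0) i < 0} = insert 1 {i : ℤ | 0 < i ∧ w i < 0} := by
      ext z
      simp only [Set.mem_ofPred_eq, Equiv.Perm.mul_apply, h0, Set.mem_insert_iff]
      split_ifs with ha hb
      · omega
      · subst hb; omega
      · simp [hb]
    rw [this, Set.ncard_insert_of_notMem (by simp; omega) hfin, Nat.even_add_one]

theorem signedGen_neg_one_eq : signedGen (-1) = signedGen 0 * signedGen 1 * signedGen 0 := by
  ext z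
  simp only [Equiv.Perm.mul_apply]
  have e1 := signedGen_apply (x := 0) (by norm_num) z
  have e2 := signedGen_apply (x := 1) (by norm_num) (signedGen 0 z)
  have e3 := signedGen_apply (x := 0) (by norm_num) (signedGen 1 (signedGen 0 z))
  have e4 := signedGen_apply (x := -1) (by norm_num) z
  rw [show src 0 = -1 from rfl, show tgt 0 = 1 from rfl] at e1 e3
  rw [show src 1 = 1 from rfl, show tgt 1 = 2 from rfl] at e2
  rw [show src (-1) = -1 from rfl, show tgt (-1) = 2 from rfl] at e4
  generalize signedGen 0 (signedGen 1 (signedGen 0 z)) = u3 at *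
  generalize signedGen 1 (signedGen 0 z) = u2 at *
  generalize signedGen 0 z = u1 at *
  generalize signedGen (-1) z = u4 at *
  split_ifs at e1 e2 e3 e4 <;> omega

/-- In type D the parity of sign changes is tracked through `t_{-1} = t_0 t_1 t_0`: the two factors
`t_0` flip it twice and `t_1` preserves it. -/
theorem mem_weylGroup_prod {a : List ℤ} (ha : ∀ x ∈ a, X.IsLetter x) :
    (a.map signedGen).prod ∈ X.weylGroup := by
  have hs := isSignedPerm_prod fun x hx => neg_one_le_of_isLetter (ha x hx)
  cases X with
  | B => exact hs
  | C => exact hs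
  | D =>
    refine ⟨hs, ?_⟩
    clear hs
    induction a using List.reverseRecOn with
    | nil =>
      have : {i : ℤ | 0 < i ∧ i < 0} = ∅ := by ext; simp; omega
      simp [this]
    | append_singleton a x ih =>
      have ih := ih fun y hy => ha y (by simp [hy])
      have hs := isSignedPerm_prod (a := a)
        fun y hy => neg_one_le_of_isLetter (ha y (by simp [hy]))
      simp only [List.map_append, List.map_cons, List.map_nil, List.prod_append,
        List.prod_singleton]
      have hx := ha x (by simp)
      rcases hx with rfl | hx
      · rw [signedGen_neg_one_eq, ← mul_assoc, ← mul_assoc,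
          even_negs_mul_zero (isSignedPerm_mul (by norm_num) (isSignedPerm_mul (by norm_num) hs)),
          even_negs_mul_pos (by norm_num), even_negs_mul_zero hs, not_not]
        exact ih
      · rw [even_negs_mul_pos (by omega)]
        exact ih

theorem Reach.isFullyCommutative (hμ : IsShape μ) (h : Reach X μ f w n) :
    X.IsFullyCommutative w := by
  refine ⟨?_, fun a b ha hb => h.reduced_connected hμ ha hb⟩
  obtain ⟨a, ⟨ha, rfl⟩, -⟩ := h.exists_word
  exact mem_weylGroup_prod ha

end ShiftedHecke

/-! ## Set-valued linear extensions and Hecke words -/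

namespace ShiftedHecke

open ClassicalType

variable {X : ClassicalType} {μ f g : ℕ → ℕ} {w w' : Equiv.Perm ℤ} {n m : ℕ}

/-- The generator index attached to a box. -/
def boxLab (X : ClassicalType) (p : ℕ × ℕ) : ℤ :=
  match X with
  | D => if p.1 = p.2 then (-1) ^ p.1 else (p.2 : ℤ) - p.1 + 1
  | _ => (p.2 : ℤ) - p.1

theorem boxLab_eq (X : ClassicalType) (i c : ℕ) : boxLab X (i + 1, i + 1 + c) = lab X i c := by
  cases X <;> simp [boxLab, lab]

/-- The boxes of the skew shape `f / μ`. -/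
def InBoxes (μ f : ℕ → ℕ) (p : ℕ × ℕ) : Prop :=
  ∃ i c, p = (i + 1, i + 1 + c) ∧ μ i ≤ c ∧ c < f i

theorem inBoxes_mk {i c : ℕ} : InBoxes μ f (i + 1, i + 1 + c) ↔ μ i ≤ c ∧ c < f i := by
  constructor
  · rintro ⟨j, d, h, h1, h2⟩
    rw [Prod.mk.injEq] at h
    obtain rfl : i = j := by omega
    obtain rfl : c = d := by omega
    exact ⟨h1, h2⟩
  · rintro ⟨h1, h2⟩
    exact ⟨i, c, rfl, h1, h2⟩

/-- `q` is the right or lower neighbour of `p`. -/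
def Cov (p q : ℕ × ℕ) : Prop := q = (p.1, p.2 + 1) ∨ q = (p.1 + 1, p.2)

/-- A set-valued linear extension of the set `S` of boxes: every box of `S` occurs, and all
occurrences of a box precede all occurrences of its right and lower neighbours. -/
def IsExt (S : ℕ × ℕ → Prop) (l : List (ℕ × ℕ)) : Prop :=
  (∀ p, p ∈ l ↔ S p) ∧ l.Pairwise fun p q => ¬ Cov q p

theorem inBoxes_remove {i : ℕ} (h : AddsBox g i f) (hi : μ i ≤ g i) (p : ℕ × ℕ) :
    InBoxes μ f p ↔ InBoxes μ g p ∨ p = (i + 1, i + 1 + g i) := by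
  have h1 := h.1
  constructor
  · rintro ⟨j, c, rfl, h2, h3⟩
    rw [inBoxes_mk]
    by_cases hj : j = i
    · subst hj
      by_cases hc : c = g j
      · subst hc; exact Or.inr rfl
      · left; omega
    · rw [h.2 j hj] at h3; exact Or.inl ⟨h2, h3⟩
  · rintro (⟨j, c, rfl, h2, h3⟩ | rfl)
    · rw [inBoxes_mk]
      by_cases hj : j = i
      · subst hj; omega
      · rw [h.2 j hj]; exact ⟨h2, h3⟩
    · rw [inBoxes_mk]; omega

theorem not_inBoxes_corner {i : ℕ} : ¬ InBoxes μ g (i + 1, i + 1 + g i) := by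
  rw [inBoxes_mk]; omega

/-- The last box of a set-valued linear extension is a corner. -/
theorem IsExt.last_corner (hμ : IsShape μ) (hf : IsShape f) {l : List (ℕ × ℕ)} {q : ℕ × ℕ}
    (h : IsExt (InBoxes μ f) (l ++ [q])) :
    ∃ i g, AddsBox g i f ∧ IsShape g ∧ μ i ≤ g i ∧ q = (i + 1, i + 1 + g i) ∧
      (q ∈ l → IsExt (InBoxes μ f) l) ∧ (q ∉ l → IsExt (InBoxes μ g) l) := by
  obtain ⟨hmem, hpw⟩ := h
  obtain ⟨i, c, hq, hc, hcf⟩ := (hmem q).1 (by simp)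
  rw [List.pairwise_append] at hpw
  have hmax : ∀ p, InBoxes μ f p → ¬ Cov q p := by
    intro p hp hcov
    have := (hmem p).2 hp
    rcases List.mem_append.1 this with h1 | h1
    · exact hpw.2.2 p h1 q (by simp) hcov
    · rw [List.mem_singleton.1 h1] at hcov
      rcases hcov with h2 | h2 <;> rw [Prod.ext_iff] at h2 <;> simp at h2
  have h1 : f i = c + 1 := by
    by_contra hcon
    refine hmax (i + 1, i + 1 + (c + 1)) (inBoxes_mk.2 (by omega)) (Or.inl ?_)
    rw [hq]; simp; omega
  -- Otherwise the box below `q` would lie in the shape. When `c = 0` the subtraction truncates, but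
  -- then row `i` has length one and row `i + 1` is empty.
  have h2 : f (i + 1) ≤ c - 1 := by
    by_contra hcon
    have e1 := hf i
    have e2 := hμ i
    refine hmax (i + 1 + 1, i + 1 + 1 + (c - 1)) (inBoxes_mk.2 (by omega)) (Or.inr ?_)
    rw [hq]; simp; omega
  have hg : AddsBox (Function.update f i c) i f :=
    ⟨by simpa using h1, fun j hj => by simp [hj]⟩
  refine ⟨i, Function.update f i c, hg, ?_, by simpa using hc, by simpa using hq, ?_, ?_⟩
  · intro k
    have e1 := hf k
    simp only [Function.update_apply]
    split_ifs with ha hb hb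
    · omega
    · subst ha; omega
    · subst hb; omega
    · omega
  · intro hql
    refine ⟨fun p => ?_, hpw.1⟩
    rw [← hmem p, List.mem_append, List.mem_singleton]
    constructor
    · exact Or.inl
    · rintro (h | rfl)
      exacts [h, hql]
  · intro hql
    refine ⟨fun p => ?_, hpw.1⟩
    have e1 := hmem p
    rw [inBoxes_remove hg (by simpa using hc) p, List.mem_append, List.mem_singleton,
      Function.update_self, ← hq] at e1
    have e2 : ¬ InBoxes μ (Function.update f i c) q := by
      have := not_inBoxes_corner (μ := μ) (g := Function.update f i c) (i := i)
      rwa [Function.update_self, ← hq] at this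
    constructor
    · intro hp
      rcases e1.1 (Or.inl hp) with h | rfl
      exacts [h, absurd hp hql]
    · intro hp
      rcases e1.2 (Or.inl hp) with h | rfl
      exacts [h, absurd hp e2]

theorem IsExt.snoc {i : ℕ} (hg : IsShape g) (hgf : AddsBox g i f) (hi : μ i ≤ g i)
    {l : List (ℕ × ℕ)} (h : IsExt (InBoxes μ f) l ∨ IsExt (InBoxes μ g) l) :
    IsExt (InBoxes μ f) (l ++ [(i + 1, i + 1 + g i)]) := by
  have hsub : ∀ p ∈ l, InBoxes μ f p := by
    intro p hp
    rcases h with h | h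
    · exact (h.1 p).1 hp
    · exact (inBoxes_remove hgf hi p).2 (Or.inl ((h.1 p).1 hp))
  refine ⟨fun p => ?_, ?_⟩
  · rw [List.mem_append, List.mem_singleton]
    constructor
    · rintro (hp | rfl)
      · exact hsub p hp
      · exact (inBoxes_remove hgf hi _).2 (Or.inr rfl)
    · intro hp
      rcases h with h | h
      · exact Or.inl ((h.1 p).2 hp)
      · rw [inBoxes_remove hgf hi, ← h.1 p] at hp; exact hp
  · rw [List.pairwise_append]
    refine ⟨h.elim (·.2) (·.2), by simp, ?_⟩
    intro p hp q hq hcov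
    rw [List.mem_singleton.1 hq] at hcov
    obtain ⟨j, c, rfl, h1, h2⟩ := hsub p hp
    have e1 := hgf.1
    have e2 := hgf.2 (i + 1) (by omega)
    have e3 := hg i
    rcases hcov with h3 | h3 <;> rw [Prod.mk.injEq] at h3
    · obtain rfl : j = i := by omega
      omega
    · obtain rfl : j = i + 1 := by omega
      omega

theorem Reach.eq_of_zero (h : Reach X μ f w 0) : f = μ := by
  cases h; rfl

theorem Reach.isExt_nil (h : Reach X μ f w n) (hl : IsExt (InBoxes μ f) []) : w = 1 := by
  cases h with
  | base => rfl
  | add i h hg hs =>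
    have := (hl.1 _).2 ((inBoxes_remove hg (h.le i) _).2 (Or.inr rfl))
    simp at this

theorem length_one (X : ClassicalType) : X.length 1 = 0 :=
  Nat.le_zero.1 (length_le (a := []) ⟨by simp, by simp⟩)

/-- Peel off the last box. If it occurs earlier, its label is already a descent and the Demazure
product absorbs it; otherwise the product grows from the shape without that corner. -/
theorem Reach.foldl_demazure (hμ : IsShape μ) (h : Reach X μ f w n) {l : List (ℕ × ℕ)}
    (hl : IsExt (InBoxes μ f) l) : (l.map (boxLab X)).foldl X.demazureGen 1 = w := by
  induction l using List.reverseRecOn generalizing f w n with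
  | nil => simpa using (h.isExt_nil hl).symm
  | append_singleton l q ih =>
    obtain ⟨i, g, hgf, hg, hi, hq, h1, h2⟩ := hl.last_corner hμ (h.isShape hμ)
    obtain ⟨m, rfl, hm⟩ := h.remove hμ hgf hg hi
    have hlq : boxLab X q = lab X i (g i) := by rw [hq, boxLab_eq]
    simp only [List.map_append, List.map_cons, List.map_nil, List.foldl_append, List.foldl_cons,
      List.foldl_nil, hlq]
    by_cases hql : q ∈ l
    · rw [ih h (h1 hql), demazureGen, if_neg]
      rw [h.length_eq hμ, hm.length_eq hμ]; omega
    · rw [ih hm (h2 hql), demazureGen, mul_signedGen_cancel (neg_one_le_lab X _ _), if_pos]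
      rw [h.length_eq hμ, hm.length_eq hμ]; omega

theorem Reach.isHeckeWord (hμ : IsShape μ) (h : Reach X μ f w n) {l : List (ℕ × ℕ)}
    (hl : IsExt (InBoxes μ f) l) : X.IsHeckeWord w (l.map (boxLab X)) := by
  refine ⟨fun x hx => ?_, h.foldl_demazure hμ hl⟩
  obtain ⟨p, hp, rfl⟩ := List.mem_map.1 hx
  obtain ⟨i, c, rfl, -, -⟩ := (hl.1 p).1 hp
  rw [boxLab_eq]
  exact lab_isLetter X i c

/-- Whether the last Demazure step lengthens the product or is absorbed, multiplying `w` by the last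
generator does not lengthen it. So that letter labels a corner, and the shape to recurse on loses
this corner only in the first case. -/
theorem Reach.exists_isExt (hμ : IsShape μ) (h : Reach X μ f w n) {a : List ℤ}
    (ha : X.IsHeckeWord w a) : ∃ l, IsExt (InBoxes μ f) l ∧ l.map (boxLab X) = a := by
  induction a using List.reverseRecOn generalizing f w n with
  | nil =>
    obtain ⟨-, ha⟩ := ha
    simp only [List.foldl_nil] at ha
    have h1 := h.length_eq hμ
    rw [← ha, length_one] at h1
    subst h1
    obtain rfl := h.eq_of_zero
    refine ⟨[], ⟨fun p => ?_, by simp⟩, rfl⟩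
    simp only [List.not_mem_nil, false_iff]
    rintro ⟨i, c, -, h1, h2⟩
    omega
  | append_singleton a x ih =>
    have hx : X.IsLetter x := ha.1 x (by simp)
    have ha' : ∀ y ∈ a, X.IsLetter y := fun y hy => ha.1 y (by simp [hy])
    have hw := ha.2
    simp only [List.foldl_append, List.foldl_cons, List.foldl_nil] at hw
    generalize hv : a.foldl X.demazureGen 1 = v at hw
    rw [demazureGen] at hw
    split_ifs at hw with hlt
    · have hvw : w * signedGen x = v := by
        rw [← hw, mul_signedGen_cancel (neg_one_le_of_isLetter hx)]
      obtain ⟨i, g, m, h1, h2, h3, h4, h5, h6⟩ := h.exists_corner hμ hx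
        (by rw [hvw, ← h.length_eq hμ, ← hw]; exact hlt.le)
      obtain ⟨l, hl, rfl⟩ := ih h6 ⟨ha', by rw [hv, hvw]⟩
      exact ⟨_, IsExt.snoc h2 h1 h3 (Or.inr hl), by simp [boxLab_eq, h4]⟩
    · subst hw
      obtain ⟨i, g, m, h1, h2, h3, h4, h5, h6⟩ := h.exists_corner hμ hx
        (by rw [← h.length_eq hμ]; omega)
      obtain ⟨l, hl, rfl⟩ := ih h ⟨ha', hv⟩
      exact ⟨_, IsExt.snoc h2 h1 h3 (Or.inl hl), by simp [boxLab_eq, h4]⟩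

/-- A corner's label determines its content, hence the length of its row, and distinct nonempty rows
have distinct lengths. -/
theorem lab_injective_corners (hf : IsShape f) {g₁ g₂ : ℕ → ℕ} {i j : ℕ} (h₁ : AddsBox g₁ i f)
    (h₂ : AddsBox g₂ j f) (h : lab X i (g₁ i) = lab X j (g₂ j)) : i = j := by
  have e1 := h₁.1
  have e2 := h₂.1
  refine hf.eq_of_eq ?_ (by omega)
  rcases lab_cases X i (g₁ i) with h' | h' | h' | h' <;>
    rcases lab_cases X j (g₂ j) with h'' | h'' | h'' | h'' <;>
    first | omega | exact absurd h''.1 h'.1 | exact absurd h'.1 h''.1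

/-- The last label identifies the last corner, and the Demazure product of the remaining labels
reveals whether that box has occurred before. -/
theorem Reach.isExt_injective (hμ : IsShape μ) (h : Reach X μ f w n) {l l' : List (ℕ × ℕ)}
    (hl : IsExt (InBoxes μ f) l) (hl' : IsExt (InBoxes μ f) l')
    (he : l.map (boxLab X) = l'.map (boxLab X)) : l = l' := by
  induction l using List.reverseRecOn generalizing f w n l' with
  | nil => simpa using he.symm
  | append_singleton l q ih =>
    rcases List.eq_nil_or_concat' l' with rfl | ⟨l', q', rfl⟩
    · simp at he
    simp only [List.map_append, List.map_cons, List.map_nil] at he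
    obtain ⟨hll, hq⟩ := List.append_inj' he rfl
    clear he
    obtain ⟨i, g, hgf, hg, hi, rfl, h1, h2⟩ := hl.last_corner hμ (h.isShape hμ)
    obtain ⟨i', g', hgf', hg', hi', rfl, h1', h2'⟩ := hl'.last_corner hμ (h.isShape hμ)
    rw [List.cons.injEq, boxLab_eq, boxLab_eq] at hq
    obtain rfl := lab_injective_corners (h.isShape hμ) hgf hgf' hq.1
    obtain rfl := hgf.left_unique hgf'
    obtain ⟨m, rfl, hm⟩ := h.remove hμ hgf hg hi
    -- Equal words cannot come from both shapes, because the elements of `f / μ` and `g / μ` have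
    -- different lengths.
    have hcontra : ∀ k k' : List (ℕ × ℕ), IsExt (InBoxes μ f) k → IsExt (InBoxes μ g) k' →
        k.map (boxLab X) = k'.map (boxLab X) → False := by
      intro k k' hk hk' hkk
      have e1 := h.foldl_demazure hμ hk
      have e2 := hm.foldl_demazure hμ hk'
      rw [hkk, e2] at e1
      have e3 := h.length_eq hμ
      have e4 := hm.length_eq hμ
      rw [← e1] at e3
      omega
    congr 1
    by_cases hql : (i + 1, i + 1 + g i) ∈ l <;> by_cases hql' : (i + 1, i + 1 + g i) ∈ l'
    · exact ih h (h1 hql) (h1' hql') hll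
    · exact (hcontra _ _ (h1 hql) (h2' hql') hll).elim
    · exact (hcontra _ _ (h1' hql') (h2 hql) hll.symm).elim
    · exact ih hm (h2 hql) (h2' hql') hll

/-! ### Contents along a linear extension -/

/-- The content of a box. -/
def content (p : ℕ × ℕ) : ℤ := (p.2 : ℤ) - p.1

theorem IsExt.of_append (hμ : IsShape μ) (hf : IsShape f) (hle : ∀ i, μ i ≤ f i)
    {l r : List (ℕ × ℕ)} (h : IsExt (InBoxes μ f) (l ++ r)) :
    ∃ g, IsShape g ∧ (∀ i, μ i ≤ g i) ∧ IsExt (InBoxes μ g) l := by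
  induction r using List.reverseRecOn generalizing f with
  | nil => exact ⟨f, hf, hle, by simpa using h⟩
  | append_singleton r q ih =>
    rw [← List.append_assoc] at h
    obtain ⟨i, g, hgf, hg, hi, -, h1, h2⟩ := h.last_corner hμ hf
    by_cases hq : q ∈ l ++ r
    · exact ih hf hle (h1 hq)
    · refine ih hg (fun j => ?_) (h2 hq)
      by_cases hj : j = i
      · rwa [hj]
      · rw [← hgf.2 j hj]; exact hle j

/-- Consecutive boxes of equal content in a set-valued linear extension coincide. -/
theorem IsExt.eq_of_content_eq (hμ : IsShape μ) (hf : IsShape f) (hle : ∀ i, μ i ≤ f i)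
    {l r : List (ℕ × ℕ)} {p q : ℕ × ℕ} (h : IsExt (InBoxes μ f) (l ++ p :: q :: r))
    (hpq : content p = content q) : p = q := by
  have h' : IsExt (InBoxes μ f) ((l ++ [p] ++ [q]) ++ r) := by simpa using h
  obtain ⟨f', hf', -, hl⟩ := h'.of_append hμ hf hle
  obtain ⟨i, g, hgf, hg, hi, rfl, h1, h2⟩ := hl.last_corner hμ hf'
  have e1 := hgf.1
  have key : ∀ j c, p = (j + 1, j + 1 + c) → c = g i := by
    rintro j c rfl
    simp only [content] at hpq
    push_cast at hpq
    omega
  by_cases hq : (i + 1, i + 1 + g i) ∈ l ++ [p]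
  · obtain ⟨j, g', hgf', -, -, hp, -, -⟩ := (h1 hq).last_corner hμ hf'
    have e2 := hgf'.1
    have e3 := key j _ hp
    obtain rfl := hf'.eq_of_eq (show f' i = f' j by omega) (by omega)
    rw [hp, e3]
  -- Here `q` is new, so `p` ends a row of the shape without `q`. Equal contents would then give two
  -- different rows of `f'` the same length.
  · obtain ⟨j, g', hgf', -, -, hp, -, -⟩ := (h2 hq).last_corner hμ hg
    have e2 := hgf'.1
    have e3 := key j _ hp
    have hji : j ≠ i := by rintro rfl; omega
    have e4 := hgf.2 j hji
    exact absurd (hf'.eq_of_eq (show f' j = f' i by omega) (by omega)) hji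

/-- A linear extension without repetitions yields the product of the generators. -/
theorem reach_of_nodup (hμ : IsShape μ) (hf : IsShape f) (hle : ∀ i, μ i ≤ f i)
    {l : List (ℕ × ℕ)} (hl : IsExt (InBoxes μ f) l) (hn : l.Nodup) :
    Reach X μ f ((l.map (boxLab X)).map signedGen).prod l.length := by
  induction l using List.reverseRecOn generalizing f with
  | nil =>
    have : f = μ := by
      funext i
      have h1 := hle i
      by_contra hne
      have := (hl.1 (i + 1, i + 1 + μ i)).2 (inBoxes_mk.2 (by omega))
      simp at this
    subst this
    simpa using Reach.base
  | append_singleton l q ih =>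
    obtain ⟨i, g, hgf, hg, hi, hq, -, h2⟩ := hl.last_corner hμ hf
    have hql : q ∉ l := by
      intro hql
      exact (List.nodup_append.1 hn).2.2 q hql q (by simp) rfl
    have h3 := ih hg (fun j => by
      by_cases hj : j = i
      · rwa [hj]
      · rw [← hgf.2 j hj]; exact hle j) (h2 hql) (List.nodup_append.1 hn).1
    have := h3.add i hgf hf
    simpa [hq, boxLab_eq] using this

/-! ## The shapes of strict partitions -/

/-- The row lengths of a strict partition. -/
def rowFn (lam : StrictPartition) (i : ℕ) : ℕ := lam.part (i + 1)

theorem isShape_rowFn (lam : StrictPartition) : IsShape (rowFn lam) := by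
  intro i
  simp only [rowFn, StrictPartition.part, Nat.add_sub_cancel]
  by_cases h : i + 1 < lam.parts.length
  · have h1 := List.pairwise_iff_getElem.1 lam.sorted i (i + 1) (by omega) h (by omega)
    rw [List.getD_eq_getElem _ _ h, List.getD_eq_getElem _ _ (by omega : i < lam.parts.length)]
    omega
  · rw [List.getD_eq_default _ _ (by omega)]
    omega

theorem mem_skewDiagram (lam mu : StrictPartition) (p : ℕ × ℕ) :
    p ∈ lam.skewDiagram mu ↔ InBoxes (rowFn mu) (rowFn lam) p := by
  obtain ⟨i, c⟩ := p
  rw [StrictPartition.skewDiagram, Finset.mem_sdiff, StrictPartition.mem_shiftedDiagram,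
    StrictPartition.mem_shiftedDiagram]
  constructor
  · rintro ⟨⟨h1, h2, h3⟩, h4⟩
    obtain ⟨i, rfl⟩ : ∃ j, i = j + 1 := ⟨i - 1, by omega⟩
    obtain ⟨c, rfl⟩ : ∃ d, c = i + 1 + d := ⟨c - (i + 1), by omega⟩
    rw [inBoxes_mk, rowFn, rowFn]
    omega
  · rintro ⟨j, d, h, h1, h2⟩
    rw [Prod.mk.injEq] at h
    obtain ⟨rfl, rfl⟩ := h
    rw [rowFn] at h1 h2
    omega

theorem rowFn_le {lam mu : StrictPartition} (hsub : mu.shiftedDiagram ⊆ lam.shiftedDiagram)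
    (i : ℕ) : rowFn mu i ≤ rowFn lam i := by
  by_contra hcon
  have h1 : (i + 1, i + 1 + rowFn lam i) ∈ mu.shiftedDiagram := by
    rw [StrictPartition.mem_shiftedDiagram]
    simp only [rowFn] at *
    omega
  have h2 := hsub h1
  rw [StrictPartition.mem_shiftedDiagram] at h2
  simp only [rowFn] at *
  omega

theorem mem_readingOrder (lam mu : StrictPartition) (p : ℕ × ℕ) :
    p ∈ lam.readingOrder mu ↔ p ∈ lam.skewDiagram mu := by
  simp [StrictPartition.readingOrder]

theorem nodup_readingOrder (lam mu : StrictPartition) : (lam.readingOrder mu).Nodup :=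
  (Finset.sort_nodup _ _).map ofLex.injective

theorem length_readingOrder (lam mu : StrictPartition) :
    (lam.readingOrder mu).length = (lam.skewDiagram mu).card := by
  simp [StrictPartition.readingOrder]

theorem isExt_readingOrder (lam mu : StrictPartition) :
    IsExt (InBoxes (rowFn mu) (rowFn lam)) (lam.readingOrder mu) := by
  refine ⟨fun p => by rw [mem_readingOrder, mem_skewDiagram], ?_⟩
  rw [StrictPartition.readingOrder, List.pairwise_map]
  refine List.Pairwise.imp ?_ (Finset.pairwise_sort _ _)
  intro a b hab hcov
  rw [Prod.Lex.le_iff] at hab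
  rcases hcov with h | h <;> rw [Prod.ext_iff] at h <;> simp only at h <;> omega

theorem reach_permB {lam mu : StrictPartition} (hsub : mu.shiftedDiagram ⊆ lam.shiftedDiagram)
    (hX : X ≠ D) :
    Reach X (rowFn mu) (rowFn lam) (lam.permB mu) (lam.skewDiagram mu).card := by
  have h := reach_of_nodup (X := X) (isShape_rowFn mu) (isShape_rowFn lam) (rowFn_le hsub)
    (isExt_readingOrder lam mu) (nodup_readingOrder lam mu)
  rw [length_readingOrder] at h
  have : lam.permB mu = (((lam.readingOrder mu).map (boxLab X)).map signedGen).prod := by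
    cases X with
    | D => exact absurd rfl hX
    | B => rfl
    | C => rfl
  rwa [this]

theorem reach_permD {lam mu : StrictPartition} (hsub : mu.shiftedDiagram ⊆ lam.shiftedDiagram) :
    Reach D (rowFn mu) (rowFn lam) (lam.permD mu) (lam.skewDiagram mu).card := by
  have h := reach_of_nodup (X := D) (isShape_rowFn mu) (isShape_rowFn lam) (rowFn_le hsub)
    (isExt_readingOrder lam mu) (nodup_readingOrder lam mu)
  rwa [length_readingOrder] at h

end ShiftedHecke

/-! ## Reading words of set-valued shifted tableaux -/

namespace ShiftedHecke

/-- A convex set of boxes on or above the main diagonal. -/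
structure IsConvexShape (D : Finset (ℕ × ℕ)) : Prop where
  le : ∀ p ∈ D, p.1 ≤ p.2
  convex : ∀ p ∈ D, ∀ q ∈ D, ∀ r : ℕ × ℕ, p.1 ≤ r.1 → p.2 ≤ r.2 → r.1 ≤ q.1 → r.2 ≤ q.2 →
    r.1 ≤ r.2 → r ∈ D

/-- A box together with one of its letters. -/
abbrev Entry : Type := (ℕ × ℕ) × MarkedLetter

/-- Sorting key: letters in increasing order, equal primed letters by decreasing content and equal
unprimed letters by increasing content. -/
def markKey (e : Entry) : MarkedLetter ×ₗ ℤ :=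
  toLex (e.2, if (ofLex e.2).2 then content e.1 else -content e.1)

theorem markKey_lt_iff {e e' : Entry} : markKey e < markKey e' ↔
    e.2 < e'.2 ∨ e.2 = e'.2 ∧
      ((ofLex e.2).2 = true ∧ content e.1 < content e'.1 ∨
        (ofLex e.2).2 = false ∧ content e'.1 < content e.1) := by
  unfold markKey
  rw [Prod.Lex.toLex_lt_toLex]
  refine or_congr Iff.rfl (and_congr_right fun h => ?_)
  simp only at h
  simp only [h]
  cases (ofLex e'.2).2 <;> simp

/-- Reading words of set-valued shifted tableaux of shape `D`. -/
structure IsReading (D : Finset (ℕ × ℕ)) (L : List Entry) : Prop where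
  sorted : L.Pairwise fun e e' => markKey e < markKey e'
  isExt : IsExt (· ∈ D) (L.map Prod.fst)

/-- The filling with a given reading word. -/
def toFilling (D : Finset (ℕ × ℕ)) (L : List Entry) : Filling D := fun p =>
  ((L.filter fun e => e.1 = p.1).map Prod.snd).toFinset

variable {D : Finset (ℕ × ℕ)} {L L' : List Entry}

theorem mem_toFilling {p : D} {x : MarkedLetter} : x ∈ toFilling D L p ↔ (p.1, x) ∈ L := by
  simp only [toFilling, List.mem_toFinset, List.mem_map, List.mem_filter, decide_eq_true_eq]
  constructor
  · rintro ⟨⟨q, y⟩, ⟨h1, rfl⟩, rfl⟩; exact h1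
  · intro h; exact ⟨_, ⟨h, rfl⟩, rfl⟩

theorem IsReading.nodup (h : IsReading D L) : L.Nodup :=
  h.sorted.imp fun hab => by rintro rfl; exact lt_irrefl _ hab

theorem IsReading.mem (h : IsReading D L) {e : Entry} (he : e ∈ L) : e.1 ∈ D :=
  (h.isExt.1 _).1 (List.mem_map_of_mem he)

theorem IsReading.lt_of_cov (h : IsReading D L) {e e' : Entry} (he : e ∈ L) (he' : e' ∈ L)
    (hc : Cov e.1 e'.1) : markKey e < markKey e' := by
  have h1 : L.Pairwise fun e e' => markKey e < markKey e' ∧ ¬ Cov e'.1 e.1 :=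
    h.sorted.and (List.pairwise_map.1 h.isExt.2)
  -- The relation is symmetrized so that it applies to any two members of the list, whatever their
  -- order in it.
  have h2 : L.Pairwise fun e e' => (markKey e < markKey e' ∧ ¬ Cov e'.1 e.1) ∨
      (markKey e' < markKey e ∧ ¬ Cov e.1 e'.1) := h1.imp Or.inl
  have hne : e ≠ e' := by
    rintro rfl
    rcases hc with hc | hc <;> rw [Prod.ext_iff] at hc <;> simp at hc
  have : Std.Symm fun e e' : Entry => (markKey e < markKey e' ∧ ¬ Cov e'.1 e.1) ∨
      (markKey e' < markKey e ∧ ¬ Cov e.1 e'.1) := ⟨fun _ _ => Or.symm⟩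
  rcases h2.forall he he' hne with h3 | h3
  · exact h3.1
  · exact absurd hc h3.2

theorem IsReading.isSemistandard (h : IsReading D L) : (toFilling D L).IsSemistandard where
  nonempty p := by
    obtain ⟨e, he, hp⟩ := List.mem_map.1 ((h.isExt.1 p.1).2 p.2)
    exact ⟨e.2, mem_toFilling.2 (by rw [← hp]; exact he)⟩
  row_le p q hpq x hx y hy := by
    have := h.lt_of_cov (mem_toFilling.1 hx) (mem_toFilling.1 hy) (Or.inl hpq)
    rcases markKey_lt_iff.1 this with h1 | h1
    exacts [h1.le, h1.1.le]
  row_inter p q hpq x hx := by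
    rw [Finset.mem_inter] at hx
    have := h.lt_of_cov (mem_toFilling.1 hx.1) (mem_toFilling.1 hx.2) (Or.inl hpq)
    rcases markKey_lt_iff.1 this with h1 | ⟨-, h1 | h1⟩
    · exact absurd h1 (lt_irrefl _)
    · exact h1.1
    · simp only [hpq, content] at h1; omega
  col_le p q hpq x hx y hy := by
    have := h.lt_of_cov (mem_toFilling.1 hx) (mem_toFilling.1 hy) (Or.inr hpq)
    rcases markKey_lt_iff.1 this with h1 | h1
    exacts [h1.le, h1.1.le]
  col_inter p q hpq x hx := by
    rw [Finset.mem_inter] at hx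
    have := h.lt_of_cov (mem_toFilling.1 hx.1) (mem_toFilling.1 hx.2) (Or.inr hpq)
    rcases markKey_lt_iff.1 this with h1 | ⟨-, h1 | h1⟩
    · exact absurd h1 (lt_irrefl _)
    · simp only [hpq, content] at h1; omega
    · unfold MarkedLetter.IsUnprimed; simp only at h1; simp [h1.1]

/-- The filling determines the set of entries, and a strictly sorted list is determined by its set
of members. -/
theorem toFilling_injOn (hL : IsReading D L) (hL' : IsReading D L')
    (h : toFilling D L = toFilling D L') : L = L' := by
  have key : ∀ e, e ∈ L ↔ e ∈ L' := by
    intro e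
    by_cases he : e.1 ∈ D
    · have h1 := mem_toFilling (L := L) (p := ⟨e.1, he⟩) (x := e.2)
      have h2 := mem_toFilling (L := L') (p := ⟨e.1, he⟩) (x := e.2)
      rw [h] at h1
      exact h1.symm.trans h2
    · exact iff_of_false (fun h1 => he (hL.mem h1)) (fun h1 => he (hL'.mem h1))
  refine List.Perm.eq_of_pairwise (le := fun e e' => markKey e < markKey e')
    (fun a b _ _ h1 h2 => absurd h1 h2.asymm) hL.sorted hL'.sorted ?_
  exact (List.perm_ext_iff_of_nodup hL.nodup hL'.nodup).2 key

variable {T : Filling D}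

/-- Walk from `p` to `q` by first going right and then down: convexity keeps the path in the shape,
and it never drops below the diagonal. -/
theorem letters_le (hD : IsConvexShape D) (hT : T.IsSemistandard) (k : ℕ) (p q : D)
    (hpq : p ≠ q) (h1 : p.1.1 ≤ q.1.1) (h2 : p.1.2 ≤ q.1.2)
    (hk : q.1.1 - p.1.1 + (q.1.2 - p.1.2) = k) : ∀ x ∈ T p, ∀ y ∈ T q, x ≤ y := by
  induction k generalizing p with
  | zero =>
    exact absurd (Subtype.ext (Prod.ext (by omega) (by omega))) hpq
  | succ k ih =>
    intro x hx y hy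
    have hp := hD.le _ p.2
    have hq := hD.le _ q.2
    rcases h2.lt_or_eq with h2 | h2
    · have hr : (p.1.1, p.1.2 + 1) ∈ D := hD.convex _ p.2 _ q.2 _ le_rfl (by simp) h1 h2
        (by simp only; omega)
      by_cases he : (⟨_, hr⟩ : D) = q
      · exact hT.row_le p q (by rw [← he]) x hx y hy
      · obtain ⟨z, hz⟩ := hT.nonempty ⟨_, hr⟩
        exact (hT.row_le p ⟨_, hr⟩ rfl x hx z hz).trans
          (ih ⟨_, hr⟩ he h1 h2 (by simp only; omega) z hz y hy)
    · have h1' : p.1.1 < q.1.1 := by omega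
      have hr : (p.1.1 + 1, p.1.2) ∈ D := hD.convex _ p.2 _ q.2 _ (by simp) le_rfl h1' h2.le
        (by simp only; omega)
      by_cases he : (⟨_, hr⟩ : D) = q
      · exact hT.col_le p q (by rw [← he]) x hx y hy
      · obtain ⟨z, hz⟩ := hT.nonempty ⟨_, hr⟩
        exact (hT.col_le p ⟨_, hr⟩ rfl x hx z hz).trans
          (ih ⟨_, hr⟩ he h1' h2.le (by simp only; omega) z hz y hy)

/-- Two equal letters on a diagonal would squeeze the box right of `p` and the box below that one to
the same letter. The row condition makes it unprimed and the column condition makes it primed. -/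
theorem not_mem_of_diagonal (hD : IsConvexShape D) (hT : T.IsSemistandard) {p q : D}
    (hc : content p.1 = content q.1) (hlt : p.1.1 < q.1.1) {x : MarkedLetter} (hx : x ∈ T p)
    (hy : x ∈ T q) : False := by
  simp only [content] at hc
  have hp := hD.le _ p.2
  have hr : (p.1.1, p.1.2 + 1) ∈ D :=
    hD.convex _ p.2 _ q.2 _ le_rfl (by simp) hlt.le (by simp only; omega) (by simp only; omega)
  have hs : (p.1.1 + 1, p.1.2 + 1) ∈ D :=
    hD.convex _ p.2 _ q.2 _ (by simp) (by simp) hlt (by simp only; omega) (by simp only; omega)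
  obtain ⟨z, hz⟩ := hT.nonempty ⟨_, hr⟩
  obtain ⟨u, hu⟩ := hT.nonempty ⟨_, hs⟩
  have h1 := hT.row_le p ⟨_, hr⟩ rfl x hx z hz
  have h2 := hT.col_le ⟨_, hr⟩ ⟨_, hs⟩ rfl z hz u hu
  have h3 : u ≤ x := by
    by_cases he : (⟨_, hs⟩ : D) = q
    · have hx' := hT.col_le ⟨_, hr⟩ ⟨_, hs⟩ rfl z hz x (by rw [he]; exact hy)
      have hzx : z = x := le_antisymm hx' h1
      subst hzx
      have e1 := hT.row_inter p ⟨_, hr⟩ rfl z (Finset.mem_inter.2 ⟨hx, hz⟩)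
      have e2 := hT.col_inter ⟨_, hr⟩ ⟨_, hs⟩ rfl z
        (Finset.mem_inter.2 ⟨hz, by rw [he]; exact hy⟩)
      exact absurd e1 e2
    · exact letters_le hD hT _ ⟨_, hs⟩ q he hlt (by simp only; omega) rfl u hu x hy
  have hzx : z = x := le_antisymm (h2.trans h3) h1
  have hux : u = x := le_antisymm h3 (h1.trans h2)
  subst hux
  subst hzx
  exact hT.col_inter ⟨_, hr⟩ ⟨_, hs⟩ rfl z (Finset.mem_inter.2 ⟨hz, hu⟩)
    (hT.row_inter p ⟨_, hr⟩ rfl z (Finset.mem_inter.2 ⟨hx, hz⟩))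

theorem eq_of_mem_of_content_eq (hD : IsConvexShape D) (hT : T.IsSemistandard) {p q : D}
    (hc : content p.1 = content q.1) {x : MarkedLetter} (hx : x ∈ T p) (hy : x ∈ T q) :
    p = q := by
  rcases lt_trichotomy p.1.1 q.1.1 with h | h | h
  · exact (not_mem_of_diagonal hD hT hc h hx hy).elim
  · refine Subtype.ext (Prod.ext h ?_)
    simp only [content] at hc; omega
  · exact (not_mem_of_diagonal hD hT hc.symm h hy hx).elim

/-! ### Sorting a tableau into its reading word -/

/-- The entries of a filling. -/
noncomputable def entries (T : Filling D) : Finset Entry :=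
  Finset.univ.biUnion fun p : D => (T p).image fun x => (p.1, x)

theorem mem_entries {e : Entry} : e ∈ entries T ↔ ∃ h : e.1 ∈ D, e.2 ∈ T ⟨e.1, h⟩ := by
  simp only [entries, Finset.mem_biUnion, Finset.mem_univ, true_and, Finset.mem_image]
  constructor
  · rintro ⟨p, x, hx, rfl⟩; exact ⟨p.2, hx⟩
  · rintro ⟨h, hx⟩; exact ⟨_, _, hx, rfl⟩

/-- Equal keys mean equal letters of equal content, hence the same entry, so sorting is strict. For
equal letters in neighbouring boxes, the direction of the content order matches the rule that rows
repeat only unprimed letters and columns only primed ones. -/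
theorem exists_reading (hD : IsConvexShape D) (hT : T.IsSemistandard) :
    ∃ L, IsReading D L ∧ toFilling D L = T := by
  let r : Entry → Entry → Prop := fun e e' => markKey e ≤ markKey e'
  have : Std.Total r := ⟨fun a b => le_total _ _⟩
  have : IsTrans Entry r := ⟨fun a b c => le_trans⟩
  have : DecidableRel r := fun _ _ => Classical.dec _
  let L := (entries T).toList.insertionSort r
  have hmem : ∀ e, e ∈ L ↔ ∃ h : e.1 ∈ D, e.2 ∈ T ⟨e.1, h⟩ := fun e => by
    rw [List.mem_insertionSort, Finset.mem_toList, mem_entries]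
  have hnd : L.Nodup := (List.perm_insertionSort r _).nodup_iff.2 (Finset.nodup_toList _)
  have hsort : L.Pairwise r := List.pairwise_insertionSort r _
  have hinj : ∀ e ∈ L, ∀ e' ∈ L, markKey e = markKey e' → e = e' := by
    intro e he e' he' h
    obtain ⟨h1, h2⟩ := (hmem e).1 he
    obtain ⟨h1', h2'⟩ := (hmem e').1 he'
    unfold markKey at h
    rw [toLex_inj, Prod.mk.injEq] at h
    obtain ⟨h3, h4⟩ := h
    have h5 : content e.1 = content e'.1 := by
      rw [h3] at h4
      split_ifs at h4
      · exact h4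
      · exact neg_injective h4
    have h6 := eq_of_mem_of_content_eq hD hT (p := ⟨_, h1⟩) (q := ⟨_, h1'⟩) h5 h2
      (by rw [h3]; exact h2')
    exact Prod.ext (congrArg Subtype.val h6) h3
  have hlt : L.Pairwise fun e e' => markKey e < markKey e' := by
    refine List.Pairwise.imp_of_mem ?_ (hsort.and hnd)
    intro a b ha hb h
    exact lt_of_le_of_ne h.1 fun he => h.2 (hinj a ha b hb he)
  refine ⟨L, ⟨hlt, fun p => ?_, ?_⟩, ?_⟩
  · rw [List.mem_map]
    constructor
    · rintro ⟨e, he, rfl⟩; exact ((hmem e).1 he).1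
    · intro hp
      obtain ⟨x, hx⟩ := hT.nonempty ⟨p, hp⟩
      exact ⟨(p, x), (hmem _).2 ⟨hp, hx⟩, rfl⟩
  · rw [List.pairwise_map]
    refine List.Pairwise.imp_of_mem ?_ hlt
    intro a b ha hb hab hcov
    obtain ⟨h1, h2⟩ := (hmem a).1 ha
    obtain ⟨h1', h2'⟩ := (hmem b).1 hb
    rcases hcov with hcov | hcov
    · have h3 := hT.row_le ⟨_, h1'⟩ ⟨_, h1⟩ hcov _ h2' _ h2
      rcases markKey_lt_iff.1 hab with h4 | ⟨h4, h5 | h5⟩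
      · exact absurd h4 h3.not_gt
      · simp only [hcov, content] at h5; omega
      · have := hT.row_inter ⟨_, h1'⟩ ⟨_, h1⟩ hcov a.2
          (Finset.mem_inter.2 ⟨by rw [h4]; exact h2', h2⟩)
        unfold MarkedLetter.IsUnprimed at this
        rw [h5.1] at this
        exact absurd this (by simp)
    · have h3 := hT.col_le ⟨_, h1'⟩ ⟨_, h1⟩ hcov _ h2' _ h2
      rcases markKey_lt_iff.1 hab with h4 | ⟨h4, h5 | h5⟩
      · exact absurd h4 h3.not_gt
      · exact hT.col_inter ⟨_, h1'⟩ ⟨_, h1⟩ hcov a.2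
          (Finset.mem_inter.2 ⟨by rw [h4]; exact h2', h2⟩) h5.1
      · simp only [hcov, content] at h5; omega
  · funext p
    ext x
    rw [mem_toFilling, hmem]
    exact ⟨fun ⟨_, h⟩ => h, fun h => ⟨p.2, h⟩⟩

theorem sum_toFilling {M : Type*} [AddCommMonoid M] (hL : IsReading D L)
    (g : MarkedLetter → M) :
    ∑ p, ∑ x ∈ toFilling D L p, g x = (L.map fun e => g e.2).sum := by
  have h1 : (L.map fun e => g e.2).sum = ∑ e ∈ L.toFinset, g e.2 :=
    (List.sum_toFinset _ hL.nodup).symm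
  rw [h1, Finset.sum_sigma', eq_comm]
  refine Finset.sum_bij' (fun e he => ⟨⟨e.1, hL.mem (List.mem_toFinset.1 he)⟩, e.2⟩)
    (fun s _ => (s.1.1, s.2)) ?_ ?_ ?_ ?_ ?_
  · intro e he
    simp only [Finset.mem_sigma, Finset.mem_univ, true_and]
    exact mem_toFilling.2 (List.mem_toFinset.1 he)
  · intro s hs
    simp only [Finset.mem_sigma, Finset.mem_univ, true_and] at hs
    exact List.mem_toFinset.2 (mem_toFilling.1 hs)
  · intro e he; rfl
  · intro s hs; rfl
  · intro e he; rfl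

theorem size_toFilling (hL : IsReading D L) : (toFilling D L).size = L.length := by
  have := sum_toFilling hL fun _ => 1
  simpa [Filling.size] using this

theorem weight_toFilling (hL : IsReading D L) : (toFilling D L).weight =
    (L.map fun e => Finsupp.single (MarkedLetter.value e.2) 1).sum :=
  sum_toFilling hL _

theorem unprimedDiagonal_toFilling_iff (hL : IsReading D L) : (toFilling D L).UnprimedDiagonal ↔
    ∀ e ∈ L, content e.1 = 0 → MarkedLetter.IsUnprimed e.2 := by
  constructor
  · intro h e he hc
    simp only [content] at hc
    exact h ⟨e.1, hL.mem he⟩ (by simp only; omega) e.2 (mem_toFilling.2 he)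
  · intro h p hp x hx
    exact h _ (mem_toFilling.1 hx) (by simp only [content]; omega)

/-- Only finitely many fillings have a given weight. -/
theorem finite_setOf_weight (d : ℕ+ →₀ ℕ) : {T : Filling D | Filling.weight T = d}.Finite := by
  classical
  -- The finite alphabet of letters whose value lies in the support of `d`; no other letter can
  -- occur.
  let A : Finset MarkedLetter := (d.support ×ˢ (Finset.univ : Finset Bool)).image toLex
  refine (Set.Finite.pi' (t := fun _ : D => (A.powerset : Set (Finset MarkedLetter)))
    fun _ => Finset.finite_toSet _).subset ?_
  rintro T rfl p
  simp only [Finset.coe_powerset, Set.mem_preimage, Set.mem_powerset_iff, Finset.coe_subset]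
  intro x hx
  simp only [A, Finset.mem_image, Finset.mem_product, Finset.mem_univ, and_true]
  refine ⟨ofLex x, ?_, rfl⟩
  rw [Finsupp.mem_support_iff]
  have h1 : Finsupp.single (MarkedLetter.value x) 1 ≤ Filling.weight T :=
    (Finset.single_le_sum (f := fun x => Finsupp.single (MarkedLetter.value x) 1)
      (fun _ _ => zero_le) hx).trans
    (Finset.single_le_sum (f := fun p => ∑ x ∈ T p, Finsupp.single (MarkedLetter.value x) 1)
      (fun _ _ => zero_le) (Finset.mem_univ p))
  have h2 := h1 (MarkedLetter.value x)
  rw [Finsupp.single_eq_same] at h2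
  exact Nat.one_le_iff_ne_zero.1 h2

end ShiftedHecke

/-! ## Counting primings -/

namespace ShiftedHecke

open ClassicalType

section Primings

variable {k : ℕ} (c : Fin k → ℤ) (b : Fin k → ℕ+)

/-- Position `i` must carry a prime because of its successor. -/
def ForcedPrimed (i : Fin k) : Prop := ∃ j : Fin k, (j : ℕ) = i + 1 ∧ b i = b j ∧ c j ≤ c i

/-- Position `i` cannot carry a prime because of its predecessor. -/
def ForcedUnprimed (i : Fin k) : Prop := ∃ h : Fin k, (i : ℕ) = h + 1 ∧ b h = b i ∧ c h ≤ c i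

/-- A choice of primes (`false` is primed) allowed at position `i`, where no primes are allowed at the
positions in `Z`. -/
def PrimeAllowed (Z : Fin k → Prop) (i : Fin k) (e : Bool) : Prop :=
  (ForcedPrimed c b i → e = false) ∧ (ForcedUnprimed c b i ∨ Z i → e = true)

/-- The sorting key attached to a choice of primes. -/
def primingKey (ε : Fin k → Bool) (i : Fin k) : MarkedLetter ×ₗ ℤ :=
  toLex (toLex (b i, ε i), if ε i then c i else -c i)

variable {c b}

theorem strictMono_of_succ {α : Type*} [Preorder α] {g : Fin k → α}
    (h : ∀ i j : Fin k, (j : ℕ) = i + 1 → g i < g j) : StrictMono g := by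
  have key : ∀ d : ℕ, ∀ i j : Fin k, (j : ℕ) = i + 1 + d → g i < g j := by
    intro d
    induction d with
    | zero => exact h
    | succ d ih =>
      intro i j hij
      exact (ih i ⟨i + 1 + d, by omega⟩ rfl).trans (h _ j (by simp only; omega))
  intro i j hij
  exact key (j - i - 1) i j (by have : (i : ℕ) < j := hij; omega)

theorem primingKey_lt_iff {ε : Fin k → Bool} {i j : Fin k} :
    primingKey c b ε i < primingKey c b ε j ↔ b i < b j ∨ b i = b j ∧
      ((ε i = false ∧ ε j = true) ∨ (ε i = false ∧ ε j = false ∧ c j < c i) ∨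
        (ε i = true ∧ ε j = true ∧ c i < c j)) := by
  unfold primingKey
  rw [Prod.Lex.toLex_lt_toLex]
  simp only [Prod.Lex.toLex_lt_toLex, toLex_inj, Prod.mk.injEq]
  rcases lt_trichotomy (b i) (b j) with h | h | h
  · simp [h]
  · simp only [h]
    cases ε i <;> cases ε j <;> simp
  · simp [h.not_gt, h.ne']

theorem monotone_of_primingKey {ε : Fin k → Bool} (h : StrictMono (primingKey c b ε)) :
    Monotone b := by
  intro i j hij
  rcases hij.eq_or_lt with rfl | hij
  · exact le_rfl
  · rcases primingKey_lt_iff.1 (h hij) with h1 | h1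
    exacts [h1.le, h1.1.le]

/-- Only successive positions matter. For equal values, a weak content descent forces a prime on the
left and a weak ascent forbids one on the right; these conditions also suffice. -/
theorem strictMono_primingKey_iff (hb : Monotone b) {ε : Fin k → Bool} :
    StrictMono (primingKey c b ε) ↔
      ∀ i, (ForcedPrimed c b i → ε i = false) ∧ (ForcedUnprimed c b i → ε i = true) := by
  constructor
  · intro h i
    constructor
    · rintro ⟨j, hj, hbj, hc⟩
      have := primingKey_lt_iff.1 (h (show i < j from Fin.lt_def.2 (by omega)))
      rw [hbj] at this
      rcases this with h1 | ⟨-, h1 | h1 | h1⟩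
      · exact absurd h1 (lt_irrefl _)
      · exact h1.1
      · exact h1.1
      · omega
    · rintro ⟨j, hj, hbj, hc⟩
      have := primingKey_lt_iff.1 (h (show j < i from Fin.lt_def.2 (by omega)))
      rw [hbj] at this
      rcases this with h1 | ⟨-, h1 | h1 | h1⟩
      · exact absurd h1 (lt_irrefl _)
      · exact h1.2
      · omega
      · exact h1.2.1
  · intro h
    refine strictMono_of_succ fun i j hij => primingKey_lt_iff.2 ?_
    rcases (hb (show i ≤ j from Fin.le_def.2 (by omega))).lt_or_eq with h1 | h1
    · exact Or.inl h1
    · refine Or.inr ⟨h1, ?_⟩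
      have h2 : c j ≤ c i → ε i = false := fun hc => (h i).1 ⟨j, hij, h1, hc⟩
      have h3 : c i ≤ c j → ε j = true := fun hc => (h j).2 ⟨i, hij, h1, hc⟩
      rcases lt_trichotomy (c i) (c j) with h4 | h4 | h4
      · have := h3 h4.le
        cases ε i <;> simp_all
      · exact Or.inl ⟨h2 h4.ge, h3 h4.le⟩
      · have := h2 h4.le
        cases ε j <;> simp_all

open Classical in
-- A weakly increasing sequence takes each of its values for a last time exactly once, and the other
-- positions repeat at their successor.
theorem card_image_add_card_adjacent (hb : Monotone b) :
    (Finset.univ.image b).card +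
      (Finset.univ.filter fun i : Fin k => ∃ j : Fin k, (j : ℕ) = i + 1 ∧ b i = b j).card = k := by
  have h1 : Finset.univ.image b = (Finset.univ.filter fun i : Fin k =>
      ¬ ∃ j : Fin k, (j : ℕ) = i + 1 ∧ b i = b j).image b := by
    ext v
    simp only [Finset.mem_image, Finset.mem_univ, true_and, Finset.mem_filter]
    constructor
    · rintro ⟨i, rfl⟩
      have hne : (Finset.univ.filter fun j => b j = b i).Nonempty := ⟨i, by simp⟩
      refine ⟨(Finset.univ.filter fun j => b j = b i).max' hne, ?_, ?_⟩
      · rintro ⟨j, hj, hbj⟩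
        have h2 := (Finset.mem_filter.1 (Finset.max'_mem _ hne)).2
        have h3 := Finset.le_max' (Finset.univ.filter fun j => b j = b i) j
          (by simp [← hbj, h2])
        rw [Fin.le_def] at h3
        omega
      · exact (Finset.mem_filter.1 (Finset.max'_mem _ hne)).2
    · rintro ⟨i, -, rfl⟩; exact ⟨i, rfl⟩
  have hlast : ∀ i j : Fin k, (¬ ∃ j : Fin k, (j : ℕ) = i + 1 ∧ b i = b j) → b i = b j →
      ¬ i < j := by
    intro i j hi hij hlt
    rw [Fin.lt_def] at hlt
    refine hi ⟨⟨i + 1, by omega⟩, rfl, le_antisymm (hb (Fin.le_def.2 (by simp))) ?_⟩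
    rw [hij]
    exact hb (Fin.le_def.2 (by simp only; omega))
  rw [h1, Finset.card_image_of_injOn, add_comm]
  · rw [Finset.card_filter_add_card_filter_not, Finset.card_univ, Fintype.card_fin]
  · intro i hi j hj hij
    have hi := (Finset.mem_filter.1 (Finset.mem_coe.1 hi)).2
    have hj := (Finset.mem_filter.1 (Finset.mem_coe.1 hj)).2
    exact le_antisymm (not_lt.1 (hlast j i hj hij.symm)) (not_lt.1 (hlast i j hi hij))

open Classical in
-- Each repetition of `b` forces its left or its right member, and forces both exactly when the
-- contents agree. This double forcing is the source of `γ`.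
theorem card_forced :
    (Finset.univ.filter (ForcedPrimed c b)).card + (Finset.univ.filter (ForcedUnprimed c b)).card =
      (Finset.univ.filter fun i : Fin k => ∃ j : Fin k, (j : ℕ) = i + 1 ∧ b i = b j).card +
      (Finset.univ.filter fun i : Fin k =>
        ∃ j : Fin k, (j : ℕ) = i + 1 ∧ c i = c j ∧ b i = b j).card := by
  have h1 : (Finset.univ.filter (ForcedUnprimed c b)).card =
      (Finset.univ.filter fun i : Fin k =>
        ∃ j : Fin k, (j : ℕ) = i + 1 ∧ b i = b j ∧ c i ≤ c j).card := by
    symm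
    refine Finset.card_bij (fun i hi => (Finset.mem_filter.1 hi).2.choose) ?_ ?_ ?_
    · intro i hi
      have h := (Finset.mem_filter.1 hi).2.choose_spec
      exact Finset.mem_filter.2 ⟨Finset.mem_univ _, i, h.1, h.2.1, h.2.2⟩
    · intro i hi j hj hij
      have h := (Finset.mem_filter.1 hi).2.choose_spec
      have h' := (Finset.mem_filter.1 hj).2.choose_spec
      rw [hij] at h
      exact Fin.ext (by omega)
    · intro j hj
      obtain ⟨i, h1, h2, h3⟩ := (Finset.mem_filter.1 hj).2
      have hi : i ∈ Finset.univ.filter fun i : Fin k =>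
          ∃ j : Fin k, (j : ℕ) = i + 1 ∧ b i = b j ∧ c i ≤ c j :=
        Finset.mem_filter.2 ⟨Finset.mem_univ _, j, h1, h2, h3⟩
      refine ⟨i, hi, Fin.ext ?_⟩
      have h := (Finset.mem_filter.1 hi).2.choose_spec
      omega
  rw [h1, ← Finset.card_union_add_card_inter]
  congr 2
  · ext i
    simp only [ForcedPrimed, Finset.mem_union, Finset.mem_filter, Finset.mem_univ, true_and]
    constructor
    · rintro (⟨j, h⟩ | ⟨j, h⟩) <;> exact ⟨j, h.1, h.2.1⟩
    · rintro ⟨j, h1, h2⟩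
      rcases le_total (c i) (c j) with h | h
      exacts [Or.inr ⟨j, h1, h2, h⟩, Or.inl ⟨j, h1, h2, h⟩]
  · ext i
    simp only [ForcedPrimed, Finset.mem_inter, Finset.mem_filter, Finset.mem_univ, true_and]
    constructor
    · rintro ⟨⟨j, h1, h2, h3⟩, j', h1', h2', h3'⟩
      obtain rfl : j = j' := Fin.ext (by omega)
      exact ⟨j, h1, le_antisymm h3' h3, h2⟩
    · rintro ⟨j, h1, h2, h3⟩
      exact ⟨⟨j, h1, h3, h2.ge⟩, j, h1, h3, h2.le⟩

open Classical in
/-- The number of allowed choices of primes. -/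
theorem ncard_primings {Z : Fin k → Prop} (hb : Monotone b)
    (hcomp : ∀ i, ForcedPrimed c b i → ¬ (ForcedUnprimed c b i ∨ Z i))
    (hZ : ∀ i, ForcedUnprimed c b i → ¬ Z i) :
    ∃ r : ℕ, {ε : Fin k → Bool | ∀ i, PrimeAllowed c b Z i (ε i)}.ncard = 2 ^ r ∧
      r + (Finset.univ.filter fun i : Fin k =>
        ∃ j : Fin k, (j : ℕ) = i + 1 ∧ c i = c j ∧ b i = b j).card + (Finset.univ.filter Z).card =
      (Finset.univ.image b).card := by
  -- The free positions, each contributing a factor two.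
  let F : Finset (Fin k) := Finset.univ.filter fun i =>
    ¬ (ForcedPrimed c b i ∨ ForcedUnprimed c b i ∨ Z i)
  refine ⟨F.card, ?_, ?_⟩
  · have h1 : {ε : Fin k → Bool | ∀ i, PrimeAllowed c b Z i (ε i)} =
        ↑(Fintype.piFinset fun i => Finset.univ.filter (PrimeAllowed c b Z i)) := by
      ext ε; simp
    rw [h1, Set.ncard_coe_finset, Fintype.card_piFinset, ← Finset.prod_const,
      Finset.prod_filter]
    refine Finset.prod_congr rfl fun i _ => ?_
    have hc := hcomp i
    by_cases h2 : ForcedPrimed c b i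
    · have h3 := hc h2
      have : Finset.univ.filter (PrimeAllowed c b Z i) = {false} := by
        ext e; simp [PrimeAllowed, h2, h3]
      rw [this]; simp [h2]
    · by_cases h3 : ForcedUnprimed c b i ∨ Z i
      · have : Finset.univ.filter (PrimeAllowed c b Z i) = {true} := by
          ext e; simp [PrimeAllowed, h2, h3]
        rw [this]; simp [h3]
      · have : Finset.univ.filter (PrimeAllowed c b Z i) = Finset.univ := by
          ext e; simp [PrimeAllowed, h2, h3]
        rw [this]; simp [h2, h3]
  · have e1 := card_image_add_card_adjacent hb
    have e2 := card_forced (c := c) (b := b)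
    have e3 : (Finset.univ.filter fun i => ForcedPrimed c b i ∨ ForcedUnprimed c b i ∨ Z i).card =
        (Finset.univ.filter (ForcedPrimed c b)).card +
          ((Finset.univ.filter (ForcedUnprimed c b)).card + (Finset.univ.filter Z).card) := by
      rw [Finset.filter_or, Finset.filter_or, Finset.card_union_of_disjoint,
        Finset.card_union_of_disjoint]
      · rw [Finset.disjoint_filter]; exact fun i _ => hZ i
      · rw [← Finset.filter_or, Finset.disjoint_filter]; exact fun i _ => hcomp i
    have e4 := Finset.card_filter_add_card_filter_not (s := (Finset.univ : Finset (Fin k)))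
      (fun i => ForcedPrimed c b i ∨ ForcedUnprimed c b i ∨ Z i)
    rw [Finset.card_univ, Fintype.card_fin] at e4
    simp only [F]
    omega

end Primings

theorem countP_eq_card_filter {α : Type*} (p : α → Bool) (a : List α) :
    a.countP p = (Finset.univ.filter fun i : Fin a.length => p (a.get i) = true).card := by
  induction a with
  | nil => simp
  | cons x a ih =>
    rw [List.countP_cons, ih, add_comm]
    have := Fin.card_filter_univ_succ (fun i : Fin (a.length + 1) => p ((x :: a).get i) = true)
    simp only [List.length_cons]
    rw [this]
    simp only [List.get_cons_zero]
    split_ifs <;> simp_all [add_comm]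

end ShiftedHecke

/-! ## Comparison of the two generating functions -/

namespace ShiftedHecke

open ClassicalType

variable {X : ClassicalType} {D : Finset (ℕ × ℕ)} {μ f : ℕ → ℕ} {w : Equiv.Perm ℤ} {n : ℕ}

/-- Reading words of the tableaux which belong to type `X`. -/
def IsTypeReading (X : ClassicalType) (D : Finset (ℕ × ℕ)) (L : List Entry) : Prop :=
  IsReading D L ∧ (X ≠ C → ∀ e ∈ L, content e.1 = 0 → MarkedLetter.IsUnprimed e.2)

/-- The pair of a word and a sequence obtained by forgetting the boxes and the primes. -/
def forget (X : ClassicalType) (L : List Entry) : (a : List ℤ) × (Fin a.length → ℕ+) :=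
  ⟨L.map fun e => boxLab X e.1,
    fun i => MarkedLetter.value (L.get (i.cast (List.length_map _))).2⟩

/-- The list of entries with given boxes, values and primes. -/
def withMarks (X : ClassicalType) (l : List (ℕ × ℕ)) (b : Fin (l.map (boxLab X)).length → ℕ+)
    (ε : Fin (l.map (boxLab X)).length → Bool) : List Entry :=
  List.ofFn fun i => (l.get (i.cast (List.length_map _)), toLex (b i, ε i))

/-- The contents of a list of boxes. -/
def contents (X : ClassicalType) (l : List (ℕ × ℕ)) (i : Fin (l.map (boxLab X)).length) : ℤ :=
  content (l.get (i.cast (List.length_map _)))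

variable {l : List (ℕ × ℕ)} {b : Fin (l.map (boxLab X)).length → ℕ+}
  {ε : Fin (l.map (boxLab X)).length → Bool}

theorem map_fst_withMarks : (withMarks X l b ε).map Prod.fst = l := by
  refine List.ext_getElem (by simp [withMarks]) fun i h1 h2 => ?_
  simp [withMarks]

theorem forget_withMarks : forget X (withMarks X l b ε) = ⟨l.map (boxLab X), b⟩ := by
  have key : ∀ (a a' : List ℤ) (c : Fin a.length → ℕ+) (c' : Fin a'.length → ℕ+) (h : a = a'),
      (∀ i, c i = c' (i.cast (by rw [h]))) →
      (⟨a, c⟩ : (a : List ℤ) × (Fin a.length → ℕ+)) = ⟨a', c'⟩ := by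
    rintro a a' c c' rfl h
    congr 1
    exact funext h
  apply key
  · intro i
    simp [withMarks, MarkedLetter.value]
    rfl
  · conv_rhs => rw [← map_fst_withMarks (X := X) (l := l) (b := b) (ε := ε)]
    rw [List.map_map]
    rfl

theorem exists_withMarks (X : ClassicalType) (L : List Entry) :
    ∃ b ε, L = withMarks X (L.map Prod.fst) b ε := by
  have hlen : ((L.map Prod.fst).map (boxLab X)).length = L.length := by simp
  refine ⟨fun i => (ofLex (L.get (i.cast hlen)).2).1, fun i => (ofLex (L.get (i.cast hlen)).2).2, ?_⟩
  refine List.ext_getElem (by simp [withMarks]) fun i h1 h2 => ?_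
  simp [withMarks]

theorem withMarks_injective : Function.Injective (withMarks X l b) := by
  intro ε ε' h
  funext i
  have := congrFun (List.ofFn_injective h) i
  simp only [Prod.mk.injEq, toLex_inj, true_and] at this
  exact this

theorem sorted_withMarks_iff :
    ((withMarks X l b ε).Pairwise fun e e' => markKey e < markKey e') ↔
      StrictMono (primingKey (contents X l) b ε) := by
  rw [withMarks, List.pairwise_ofFn]
  rfl

theorem unprimed_withMarks_iff :
    (∀ e ∈ withMarks X l b ε, content e.1 = 0 → MarkedLetter.IsUnprimed e.2) ↔
      ∀ i, contents X l i = 0 → ε i = true := by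
  simp only [withMarks, List.mem_ofFn, forall_exists_index, forall_apply_eq_imp_iff]
  rfl

theorem isTypeReading_withMarks_iff (hl : IsExt (· ∈ D) l) (hb : Monotone b) :
    IsTypeReading X D (withMarks X l b ε) ↔
      ∀ i, PrimeAllowed (contents X l) b (fun i => X ≠ C ∧ contents X l i = 0) i (ε i) := by
  have h1 : IsReading D (withMarks X l b ε) ↔ StrictMono (primingKey (contents X l) b ε) := by
    rw [← sorted_withMarks_iff]
    exact ⟨fun h => h.sorted, fun h => ⟨h, by rwa [map_fst_withMarks]⟩⟩
  rw [IsTypeReading, h1, unprimed_withMarks_iff, strictMono_primingKey_iff hb]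
  constructor
  · rintro ⟨h2, h3⟩ i
    exact ⟨(h2 i).1, fun h => h.elim (h2 i).2 fun h => h3 h.1 i h.2⟩
  · intro h
    exact ⟨fun i => ⟨(h i).1, fun h' => (h i).2 (Or.inl h')⟩,
      fun hX i hi => (h i).2 (Or.inr ⟨hX, hi⟩)⟩

theorem isConvexShape_skewDiagram (lam mu : StrictPartition) :
    IsConvexShape (lam.skewDiagram mu) := by
  constructor
  · intro p hp
    obtain ⟨i, c, rfl, -, -⟩ := (mem_skewDiagram _ _ _).1 hp
    simp
  · intro p hp q hq r h1 h2 h3 h4 h5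
    obtain ⟨i, c, rfl, hc, -⟩ := (mem_skewDiagram _ _ _).1 hp
    obtain ⟨j, d, rfl, -, hd⟩ := (mem_skewDiagram _ _ _).1 hq
    obtain ⟨u, v⟩ := r
    simp only at h1 h2 h3 h4 h5
    rw [mem_skewDiagram]
    obtain ⟨u, rfl⟩ : ∃ u', u = u' + 1 := ⟨u - 1, by omega⟩
    obtain ⟨v, rfl⟩ : ∃ v', v = u + 1 + v' := ⟨v - (u + 1), by omega⟩
    rw [inBoxes_mk]
    have e1 := (isShape_rowFn mu).le_sub (show i ≤ u by omega)
    have e2 := (isShape_rowFn lam).le_sub (show u ≤ j by omega)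
    omega

theorem abs_boxLab {p : ℕ × ℕ} (hp : p.1 ≤ p.2) :
    0 ≤ content p ∧ |boxLab X p| = content p + shift X ∧
      (X ≠ ClassicalType.D → boxLab X p = content p) := by
  have h0 : 0 ≤ content p := by simp only [content]; omega
  refine ⟨h0, ?_, ?_⟩
  · cases X with
    | B => simpa [shift, boxLab, content] using abs_of_nonneg h0
    | C => simpa [shift, boxLab, content] using abs_of_nonneg h0
    | D =>
      simp only [boxLab, shift, content]
      split_ifs with h
      · rw [abs_neg_one_pow]; omega
      · rw [abs_of_nonneg]; all_goals omega
  · intro hX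
    cases X with
    | B => rfl
    | C => rfl
    | D => exact absurd rfl hX

/-- The relevant properties of the contents of the letters of a set-valued linear extension. -/
structure ContentSpec (X : ClassicalType) {k : ℕ} (a c : Fin k → ℤ) : Prop where
  nonneg : ∀ i, 0 ≤ c i
  abs_eq : ∀ i, |a i| = c i + shift X
  eq_of_ne : X ≠ ClassicalType.D → ∀ i, a i = c i
  eq_of_adjacent : ∀ i j : Fin k, (j : ℕ) = i + 1 → c i = c j → a i = a j

theorem contentSpec (hμ : IsShape μ) (hf : IsShape f) (hle : ∀ i, μ i ≤ f i)
    (hl : IsExt (InBoxes μ f) l) :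
    ContentSpec X (l.map (boxLab X)).get (contents X l) := by
  have hlab : ∀ i, (l.map (boxLab X)).get i = boxLab X (l.get (i.cast (List.length_map _))) := by
    intro i; simp
  have hmem : ∀ i : Fin l.length, (l.get i).1 ≤ (l.get i).2 := by
    intro i
    obtain ⟨j, c, h, -, -⟩ := (hl.1 _).1 (List.get_mem l i)
    rw [h]; simp
  refine ⟨fun i => (abs_boxLab (X := X) (hmem _)).1, fun i => ?_, fun hX i => ?_, ?_⟩
  · rw [hlab]; exact (abs_boxLab (hmem _)).2.1
  · rw [hlab]; exact (abs_boxLab (hmem _)).2.2 hX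
  · intro i j hij hc
    rw [hlab, hlab]
    congr 1
    have hj : (j : ℕ) < l.length := by simpa using j.2
    have hsplit : l = l.take i ++ l.get (i.cast (List.length_map _)) ::
        l.get (j.cast (List.length_map _)) :: l.drop (i + 2) := by
      have h1 : l.drop i = l[(i : ℕ)] :: l.drop (i + 1) := List.drop_eq_getElem_cons (by omega)
      have h2 : l.drop (i + 1) = l[(i : ℕ) + 1] :: l.drop (i + 1 + 1) :=
        List.drop_eq_getElem_cons (by omega)
      conv_lhs => rw [← List.take_append_drop i l, h1, h2]
      simp [hij]
    rw [hsplit] at hl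
    exact hl.eq_of_content_eq hμ hf hle hc

/-- A peak with constant `b` is a position forced both primed and unprimed. The extra conditions in
types B and D exclude a diagonal position forced to be primed; for type D, `eq_of_adjacent` supplies
the equality of labels. -/
theorem isCompatible_iff {a : List ℤ} {c : Fin a.length → ℤ} (hs : ContentSpec X a.get c)
    {b : Fin a.length → ℕ+} : X.IsCompatible a b ↔ Monotone b ∧ ∀ i, ForcedPrimed c b i →
      ¬ (ForcedUnprimed c b i ∨ (X ≠ C ∧ c i = 0)) := by
  have habs : ∀ i j, |a.get i| ≤ |a.get j| ↔ c i ≤ c j := fun i j => by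
    rw [hs.abs_eq, hs.abs_eq]; omega
  constructor
  · intro h
    refine ⟨h.monotone, ?_⟩
    rintro i ⟨j, hij, hb, hc⟩ (⟨m, hm, hb', hc'⟩ | ⟨hX, hi⟩)
    · have := h.peak m i j hm hij ((habs _ _).2 hc') ((habs _ _).2 hc)
      rw [hb', hb] at this
      exact lt_irrefl _ this
    · have hj : c j = 0 := le_antisymm (hc.trans hi.le) (hs.nonneg j)
      have hne : ¬ b i < b j := by rw [hb]; exact lt_irrefl _
      have ha := hs.eq_of_adjacent i j hij (by rw [hi, hj])
      have ha1 := hs.abs_eq i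
      cases X with
      | C => exact hX rfl
      | B =>
        have h1 := hs.eq_of_ne (by simp)
        exact hne (h.typeB rfl i j hij (by rw [h1, hi])
          (by rw [← ha, hs.eq_of_ne (by simp), hi]))
      | D =>
        have h2 : |a.get i| = 1 := by rw [ha1, hi]; rfl
        exact hne (h.typeD rfl i j hij ha (eq_or_eq_neg_of_abs_eq h2))
  · rintro ⟨hb, h⟩
    have key : ∀ i j : Fin a.length, (j : ℕ) = i + 1 → c i = 0 → c j = 0 → X ≠ C → b i < b j := by
      intro i j hij hi hj hX
      refine lt_of_le_of_ne (hb (Fin.le_def.2 (by omega))) fun hbb => ?_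
      exact h i ⟨j, hij, hbb, by rw [hi, hj]⟩ (Or.inr ⟨hX, hi⟩)
    refine ⟨hb, ?_, ?_, ?_⟩
    · intro i j m hij hjm h1 h2
      have e1 := hb (show i ≤ j from Fin.le_def.2 (by omega))
      have e2 := hb (show j ≤ m from Fin.le_def.2 (by omega))
      refine lt_of_le_of_ne (e1.trans e2) fun he => ?_
      have e3 : b j = b i := le_antisymm (by rw [he]; exact e2) e1
      exact h j ⟨m, hjm, by rw [e3, he], (habs _ _).1 h2⟩
        (Or.inl ⟨i, hij, e3.symm, (habs _ _).1 h1⟩)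
    · rintro rfl i j hij hi hj
      rw [hs.eq_of_ne (by simp)] at hi hj
      exact key i j hij hi hj (by simp)
    · rintro rfl i j hij haij hai
      have h0 : ∀ m, (a.get m = 1 ∨ a.get m = -1) → c m = 0 := by
        intro m hm
        have h1 := hs.abs_eq m
        have h2 : |a.get m| = 1 := by rcases hm with h | h <;> rw [h] <;> simp
        rw [h2] at h1
        simp only [shift] at h1
        omega
      exact key i j hij (h0 i hai) (h0 j (by rwa [← haij])) (by simp)

open Classical in
theorem oStat_eq {a : List ℤ} {c : Fin a.length → ℤ} (hs : ContentSpec X a.get c) :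
    X.oStat a = (Finset.univ.filter fun i => X ≠ C ∧ c i = 0).card := by
  cases X with
  | B =>
    rw [oStat, countP_eq_card_filter]
    congr 1
    ext i
    have := hs.eq_of_ne (by simp) i
    simp [← this]
  | C => simp [oStat]
  | D =>
    rw [oStat, countP_eq_card_filter]
    congr 1
    ext i
    have h1 := hs.abs_eq i
    simp only [shift] at h1
    simp only [Finset.mem_filter, Finset.mem_univ, true_and, decide_eq_true_eq, ne_eq,
      reduceCtorEq, not_false_eq_true]
    rw [← abs_eq (zero_le_one' ℤ), h1]
    omega

open Classical in
theorem gammaStat_eq {a : List ℤ} {c : Fin a.length → ℤ} (hs : ContentSpec X a.get c)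
    (b : Fin a.length → ℕ+) :
    gammaStat a b = (Finset.univ.filter fun i : Fin a.length =>
        ∃ j : Fin a.length, (j : ℕ) = i + 1 ∧ c i = c j ∧ b i = b j).card := by
  rw [gammaStat, ← Set.ncard_coe_finset]
  congr 1
  ext i
  simp only [Set.mem_ofPred_eq, Finset.coe_filter, Finset.mem_univ, true_and]
  refine exists_congr fun j => and_congr_right fun hij => and_congr_left fun _ => ?_
  constructor
  · intro h
    have h1 := hs.abs_eq i
    have h2 := hs.abs_eq j
    rw [h] at h1
    omega
  · exact hs.eq_of_adjacent i j hij

/-- The number of tableaux with a given Hecke word and compatible sequence. -/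
theorem ncard_fiber (hμ : IsShape μ) (hD : ∀ p, p ∈ D ↔ InBoxes μ f p) (h : Reach X μ f w n)
    {a : List ℤ} {b : Fin a.length → ℕ+} (ha : X.IsHeckeWord w a) (hb : X.IsCompatible a b) :
    ∃ r : ℕ, {L | IsTypeReading X D L ∧ forget X L = ⟨a, b⟩}.ncard = 2 ^ r ∧
      r + gammaStat a b + X.oStat a = (Finset.univ.image b).card := by
  classical
  obtain ⟨l, hl, rfl⟩ := h.exists_isExt hμ ha
  have hs := contentSpec (X := X) hμ (h.isShape hμ) h.le hl
  obtain ⟨hmono, hcomp⟩ := (isCompatible_iff hs).1 hb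
  have hlD : IsExt (· ∈ D) l := ⟨fun p => (hl.1 p).trans (hD p).symm, hl.2⟩
  -- The side condition holds because a diagonal letter forced unprimed would have a diagonal
  -- predecessor of the same value, which would be forced primed on the diagonal.
  obtain ⟨r, hr, hr'⟩ := ncard_primings hmono hcomp (by
    rintro i ⟨m, hm, hbm, hcm⟩ ⟨hX, hi⟩
    have hm0 : contents X l m = 0 := le_antisymm (hcm.trans hi.le) (hs.nonneg m)
    exact hcomp m ⟨i, hm, hbm, by rw [hm0, hi]⟩ (Or.inr ⟨hX, hm0⟩))
  refine ⟨r, ?_, ?_⟩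
  · rw [← hr, ← Set.ncard_image_of_injective _ (withMarks_injective (X := X) (l := l) (b := b))]
    congr 1
    ext L
    constructor
    · rintro ⟨hL, hLab⟩
      -- The Hecke word determines the boxes by `Reach.isExt_injective`, so only the primes `ε` vary
      -- within the fibre.
      obtain ⟨b', ε, hLm⟩ := exists_withMarks X L
      have hfst : L.map Prod.fst = l := by
        refine h.isExt_injective hμ ⟨fun p => ?_, hL.1.isExt.2⟩ hl ?_
        · exact (hL.1.isExt.1 p).trans (hD p)
        · rw [List.map_map]
          exact congrArg Sigma.fst hLab
      generalize L.map Prod.fst = l' at *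
      subst hfst
      rw [hLm, forget_withMarks] at hLab
      obtain rfl : b' = b := by simpa using hLab
      rw [hLm] at hL
      exact ⟨ε, (isTypeReading_withMarks_iff hlD hmono).1 hL, hLm.symm⟩
    · rintro ⟨ε, hε, rfl⟩
      exact ⟨(isTypeReading_withMarks_iff hlD hmono).2 hε, forget_withMarks⟩
  · rw [gammaStat_eq hs, oStat_eq hs]
    convert hr'

theorem forget_mem (hμ : IsShape μ) (hD : ∀ p, p ∈ D ↔ InBoxes μ f p) (h : Reach X μ f w n)
    {L : List Entry} (hL : IsTypeReading X D L) :
    X.IsHeckeWord w (forget X L).1 ∧ X.IsCompatible (forget X L).1 (forget X L).2 := by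
  obtain ⟨b, ε, hLm⟩ := exists_withMarks X L
  have hlD : IsExt (· ∈ D) (L.map Prod.fst) := hL.1.isExt
  generalize L.map Prod.fst = l at *
  subst hLm
  have hl : IsExt (InBoxes μ f) l := ⟨fun p => (hlD.1 p).trans (hD p), hlD.2⟩
  have hs := contentSpec (X := X) hμ (h.isShape hμ) h.le hl
  rw [forget_withMarks]
  refine ⟨h.isHeckeWord hμ hl, ?_⟩
  have hmono : Monotone b := monotone_of_primingKey (sorted_withMarks_iff.1 hL.1.sorted)
  have hε := (isTypeReading_withMarks_iff hlD hmono).1 hL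
  refine (isCompatible_iff hs).2 ⟨hmono, fun i h1 h2 => ?_⟩
  have e1 := (hε i).1 h1
  rw [(hε i).2 h2] at e1
  exact absurd e1 (by simp)

/-! ### Summation over the fibres of `forget` -/

theorem sum_forget (X : ClassicalType) {M : Type*} [AddCommMonoid M] (g : ℕ+ → M) (L : List Entry) :
    ∑ i, g ((forget X L).2 i) = (L.map fun e => g (MarkedLetter.value e.2)).sum := by
  rw [← Fin.sum_univ_fun_getElem L fun e => g (MarkedLetter.value e.2)]
  exact Fintype.sum_equiv (finCongr (List.length_map _)) _ _ fun i => rfl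

theorem forget_weight {L : List Entry} (hL : IsReading D L) :
    ∑ i, Finsupp.single ((forget X L).2 i) 1 = (toFilling D L).weight := by
  rw [weight_toFilling hL, sum_forget X fun k => Finsupp.single k 1]

/-- The tableaux which belong to type `X`. -/
def typeTableaux (X : ClassicalType) (D : Finset (ℕ × ℕ)) : Set (Filling D) :=
  {T | T.IsSemistandard ∧ (X ≠ C → T.UnprimedDiagonal)}

theorem bijOn_toFilling (X : ClassicalType) (hD : IsConvexShape D) (d : ℕ+ →₀ ℕ) :
    Set.BijOn (toFilling D) {L | IsTypeReading X D L ∧ (toFilling D L).weight = d}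
      {T | T ∈ typeTableaux X D ∧ Filling.weight T = d} := by
  refine ⟨?_, ?_, ?_⟩
  · rintro L ⟨hL, hd⟩
    exact ⟨⟨hL.1.isSemistandard, fun hX => (unprimedDiagonal_toFilling_iff hL.1).2 (hL.2 hX)⟩, hd⟩
  · rintro L ⟨hL, -⟩ L' ⟨hL', -⟩ h
    exact toFilling_injOn hL.1 hL'.1 h
  · rintro T ⟨⟨hT, hX⟩, hd⟩
    obtain ⟨L, hL, rfl⟩ := exists_reading hD hT
    exact ⟨L, ⟨⟨hL, fun h => (unprimedDiagonal_toFilling_iff hL).1 (hX h)⟩, hd⟩, rfl⟩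

/-- Both coefficients at `d` become sums over the finite set of reading words of weight `d`, grouped
by their image under `forget`. A fibre of size `2 ^ r` supplies the coefficient, and the size of a
tableau is the length of its word. -/
theorem kStanley_eq (hμ : IsShape μ) (hconv : IsConvexShape D)
    (hD : ∀ p, p ∈ D ↔ InBoxes μ f p) (h : Reach X μ f w n) :
    X.kStanley w = toRatSeries (formalSum (typeTableaux X D)
      (fun T => Polynomial.X ^ (Filling.size T - n)) fun T => Filling.weight T) := by
  classical
  ext1 d
  have hbij := bijOn_toFilling X hconv d
  have hfin : {L | IsTypeReading X D L ∧ (toFilling D L).weight = d}.Finite := by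
    refine Set.Finite.of_finite_image ?_ hbij.injOn
    rw [hbij.image_eq]
    exact (finite_setOf_weight d).subset fun T hT => hT.2
  let M := hfin.toFinset
  have hM : ∀ L, L ∈ M ↔ IsTypeReading X D L ∧ (toFilling D L).weight = d := fun L =>
    hfin.mem_toFinset
  have hR : MvPowerSeries.coeff d (toRatSeries (formalSum (typeTableaux X D)
      (fun T => Polynomial.X ^ (Filling.size T - n)) fun T => Filling.weight T)) =
      ∑ L ∈ M, Polynomial.X ^ ((forget X L).1.length - n) := by
    have h1 : MvPowerSeries.coeff d (formalSum (typeTableaux X D)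
        (fun T => (Polynomial.X : Polynomial ℤ) ^ (Filling.size T - n))
        fun T => Filling.weight T) =
        ∑ᶠ T ∈ {T | T ∈ typeTableaux X D ∧ Filling.weight T = d},
          Polynomial.X ^ (Filling.size T - n) := rfl
    rw [toRatSeries, MvPowerSeries.coeff_map, h1,
      ← finsum_mem_eq_of_bijOn (f := fun L : List Entry => Polynomial.X ^ (L.length - n)) _ hbij
        (fun L hL => by rw [size_toFilling hL.1.1]),
      finsum_mem_eq_finite_toFinset_sum _ hfin, map_sum]
    refine Finset.sum_congr rfl fun L _ => ?_
    simp [forget]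
  have himage : {p : (a : List ℤ) × (Fin a.length → ℕ+) |
      (X.IsHeckeWord w p.1 ∧ X.IsCompatible p.1 p.2) ∧ ∑ i, Finsupp.single (p.2 i) 1 = d} =
      ↑(M.image (forget X)) := by
    ext ⟨a, b⟩
    simp only [Set.mem_ofPred_eq, Finset.coe_image, Set.mem_image, SetLike.mem_coe, hM]
    constructor
    · rintro ⟨⟨ha, hb⟩, hd⟩
      obtain ⟨r, hr, -⟩ := ncard_fiber hμ hD h ha hb
      have hne : {L | IsTypeReading X D L ∧ forget X L = ⟨a, b⟩}.Nonempty := by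
        apply Set.nonempty_of_ncard_ne_zero
        rw [hr]; positivity
      obtain ⟨L, hL, hLab⟩ := hne
      refine ⟨L, ⟨hL, ?_⟩, hLab⟩
      rw [← forget_weight (X := X) hL.1, hLab]
      exact hd
    · rintro ⟨L, ⟨hL, hd⟩, hLab⟩
      have h1 := forget_mem hμ hD h hL
      have h2 := forget_weight (X := X) hL.1
      rw [hLab] at h1 h2
      exact ⟨h1, h2.trans hd⟩
  have hL : MvPowerSeries.coeff d (X.kStanley w) =
      ∑ p ∈ M.image (forget X), Polynomial.C ((2 : ℚ) ^
        (((Finset.univ.image p.2).card : ℤ) - (gammaStat p.1 p.2 : ℤ) - (X.oStat p.1 : ℤ))) *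
      Polynomial.X ^ (p.1.length - n) := by
    rw [← finsum_mem_coe_finset, ← himage, ← h.length_eq hμ]
    rfl
  rw [hR, hL, Finset.sum_comp (fun p : (a : List ℤ) × (Fin a.length → ℕ+) =>
    (Polynomial.X : Polynomial ℚ) ^ (p.1.length - n)) (forget X)]
  refine Finset.sum_congr rfl fun p hp => ?_
  have hp' : p ∈ (↑(M.image (forget X)) : Set _) := hp
  rw [← himage] at hp'
  obtain ⟨⟨ha, hb⟩, hd⟩ := hp'
  obtain ⟨r, hr, hr'⟩ := ncard_fiber hμ hD h ha hb
  have hcard : (M.filter fun L => forget X L = p).card = 2 ^ r := by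
    rw [← hr, ← Set.ncard_coe_finset]
    congr 1
    ext L
    simp only [Finset.coe_filter, hM, Set.mem_ofPred_eq]
    constructor
    · exact fun h => ⟨h.1.1, h.2⟩
    · rintro ⟨h1, h2⟩
      refine ⟨⟨h1, ?_⟩, h2⟩
      rw [← forget_weight (X := X) h1.1, h2]
      exact hd
  have hexp : ((Finset.univ.image p.2).card : ℤ) - (gammaStat p.1 p.2 : ℤ) -
      (X.oStat p.1 : ℤ) = r := by
    rw [← hr']; push_cast; ring
  rw [hcard, hexp, zpow_natCast, nsmul_eq_mul]
  simp only [map_pow, map_ofNat, Nat.cast_pow, Nat.cast_ofNat]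

end ShiftedHecke

theorem mainTheorem7 (lam mu : StrictPartition)
    (hsub : mu.shiftedDiagram ⊆ lam.shiftedDiagram) :
    ClassicalType.B.IsFullyCommutative (lam.permB mu) ∧
    ClassicalType.C.IsFullyCommutative (lam.permB mu) ∧
    ClassicalType.D.IsFullyCommutative (lam.permD mu) ∧
    ClassicalType.B.kStanley (lam.permB mu) = toRatSeries (skewGP lam mu) ∧
    ClassicalType.C.kStanley (lam.permB mu) = toRatSeries (skewGQ lam mu) ∧
    ClassicalType.D.kStanley (lam.permD mu) = toRatSeries (skewGP lam mu) := by
  have hμ := ShiftedHecke.isShape_rowFn mu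
  have hD := ShiftedHecke.mem_skewDiagram lam mu
  have hconv := ShiftedHecke.isConvexShape_skewDiagram lam mu
  have hB := ShiftedHecke.reach_permB (X := ClassicalType.B) hsub (by simp)
  have hC := ShiftedHecke.reach_permB (X := ClassicalType.C) hsub (by simp)
  have hDD := ShiftedHecke.reach_permD hsub
  refine ⟨hB.isFullyCommutative hμ, hC.isFullyCommutative hμ, hDD.isFullyCommutative hμ, ?_, ?_, ?_⟩
  · rw [ShiftedHecke.kStanley_eq hμ hconv hD hB]
    simp [skewGP, ShiftedHecke.typeTableaux]
  · rw [ShiftedHecke.kStanley_eq hμ hconv hD hC]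
    simp [skewGQ, ShiftedHecke.typeTableaux]
  · rw [ShiftedHecke.kStanley_eq hμ hconv hD hDD]
    simp [skewGP, ShiftedHecke.typeTableaux]
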